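/- An operator space structure on a complex normed space $V$ is a sequence of norms $\|\cdot\|_n$ on the matrix spaces $M_n(V)$, with $\|\cdot\|_1$ the norm of $V$, such that $\|v\oplus w\|_{m+n}=\max(\|v\|_m,\|w\|_n)$ and $\|\alpha v\beta\|_n\le\|\alpha\|\,\|v\|_m\,\|\beta\|$ for $v\in M_m(V)$, $w\in M_n(V)$ in the first identity, and $\alpha\in M_{n,m}(\mathbb C)$, $v\in M_m(V)$, $\beta\in M_{m,n}(\mathbb C)$ in the second. The minimal structure $\min V$ is given by $\|[v_{ij}]\|_n=\sup\{\|[f(v_{ij})]\|_{M_n(\mathbb C)} : f\in V^*,\ \|f\|\le 1\}$, and the dual $V^*$ of an operator space $V$ carries the structure in which $\|[\varphi_{ij}]\|_n$ is the supremum of $\|[\varphi_{ij}(x_{kl})]\|_{M_{nm}(\mathbb C)}$ over all $m$ and all $x\in M_m(V)$ with $\|x\|_m\le 1$. A linear map $T$ is completely bounded if $\|[T v_{ij}]\|_n\le C\|[v_{ij}]\|_n$ with $C$ independent of $n$ and $v$; a bilinear map $u$ is completely bounded if $\|[u(v_{ij},w_{kl})]\|_{mn}\le C\|v\|_m\|w\|_n$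 with $C$ independent of $m,n,v,w$. Let $\mathfrak A$ be a Banach algebra (not necessarily unital) with an operator space structure. An operator $\mathfrak A$-bimodule is a complete operator space $E$ that is an $\mathfrak A$-bimodule whose two module actions $\mathfrak A\times E\to E$ are completely bounded bilinear maps; $E^*$ is an $\mathfrak A$-bimodule via $(a\cdot\varphi)(x)=\varphi(x\cdot a)$ and $(\varphi\cdot a)(x)=\varphi(a\cdot x)$. The algebra $\mathfrak A$ is operator amenable if, for every operator $\mathfrak A$-bimodule $E$, every completely bounded linear map $D\colon\mathfrak A\to E^*$ with $D(ab)=a\cdot D(b)+D(a)\cdot b$ is inner, i.e. there is $\varphi\in E^*$ with $D(a)=a\cdot\varphi-\varphi\cdot a$ for all $a\in\mathfrak A$. **Theorem.** Let $\mathcal B$ be a commutative $C^*$-algebra (not necessarily unital) and let $\mathfrak A\subseteq\mathcal B$ be a uniform algebra, that is, a closed (not necessarily unital) complex subalgebra. If $\min\mathfrak A$ is operator amenable, then $\mathfrak A$ is a commutative $C^*$-algebra; precisely, $\mathfrak A$ is a closed $*$-subalgebra of $\mathcal B$. -/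

import Mathlib

open scoped Matrix.Norms.L2Operator

universe u

namespace OpSp

/-! Complex matrices carry the operator norm between Euclidean spaces. -/

section ScalarMatrices

variable {ι κ ι' κ' : Type*} [Fintype ι] [Fintype κ] [DecidableEq κ] [Fintype ι'] [Fintype κ']
  [DecidableEq κ']

lemma sq_norm_mulVec_le (A : Matrix ι κ ℂ) (x : κ → ℂ) :
    ∑ i, ‖(A.mulVec x) i‖ ^ 2 ≤ ‖A‖ ^ 2 * ∑ j, ‖x j‖ ^ 2 := by
  have h := Matrix.l2_opNorm_mulVec A (WithLp.toLp 2 x)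
  have h2 := pow_le_pow_left₀ (norm_nonneg _) h 2
  rw [mul_pow, EuclideanSpace.norm_sq_eq, EuclideanSpace.norm_sq_eq] at h2
  exact h2

lemma l2_norm_le (A : Matrix ι κ ℂ) {C : ℝ} (hC : 0 ≤ C)
    (h : ∀ x : κ → ℂ, ∑ i, ‖(A.mulVec x) i‖ ^ 2 ≤ C ^ 2 * ∑ j, ‖x j‖ ^ 2) : ‖A‖ ≤ C := by
  rw [Matrix.l2_opNorm_def]
  refine ContinuousLinearMap.opNorm_le_bound _ hC fun x => ?_
  refine le_of_sq_le_sq ?_ (by positivity)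
  rw [mul_pow, EuclideanSpace.norm_sq_eq, EuclideanSpace.norm_sq_eq]
  exact h x.ofLp
where
  le_of_sq_le_sq {a b : ℝ} (h : a ^ 2 ≤ b ^ 2) (hb : 0 ≤ b) : a ≤ b := by
    exact le_of_abs_le (abs_le_of_sq_le_sq h hb)

lemma l2_norm_reindex_le (e : ι ≃ ι') (f : κ ≃ κ') (A : Matrix ι κ ℂ) :
    ‖Matrix.reindex e f A‖ ≤ ‖A‖ := by
  refine l2_norm_le _ (norm_nonneg _) fun x => ?_
  have h := sq_norm_mulVec_le A (x ∘ f)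
  have e1 : ∑ j, ‖(x ∘ f) j‖ ^ 2 = ∑ j, ‖x j‖ ^ 2 := Equiv.sum_comp f (fun j => ‖x j‖ ^ 2)
  rw [e1] at h
  refine le_trans (le_of_eq ?_) h
  rw [← Equiv.sum_comp e]
  refine Finset.sum_congr rfl fun i _ => ?_
  congr 2
  simp only [Matrix.mulVec, dotProduct, Matrix.reindex_apply, Matrix.submatrix_apply,
    Equiv.symm_apply_apply, Function.comp]
  rw [← Equiv.sum_comp f]
  simp

lemma l2_norm_fromBlocks_le (A : Matrix ι κ ℂ) (B : Matrix ι' κ' ℂ) :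
    ‖Matrix.fromBlocks A 0 0 B‖ ≤ max ‖A‖ ‖B‖ := by
  have h0 : 0 ≤ max ‖A‖ ‖B‖ := le_max_of_le_left (norm_nonneg _)
  refine l2_norm_le _ h0 fun x => ?_
  have hA := sq_norm_mulVec_le A (x ∘ Sum.inl)
  have hB := sq_norm_mulVec_le B (x ∘ Sum.inr)
  have hA2 : ‖A‖ ^ 2 ≤ max ‖A‖ ‖B‖ ^ 2 := pow_le_pow_left₀ (norm_nonneg _) (le_max_left _ _) 2
  have hB2 : ‖B‖ ^ 2 ≤ max ‖A‖ ‖B‖ ^ 2 := pow_le_pow_left₀ (norm_nonneg _) (le_max_right _ _) 2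
  rw [Matrix.fromBlocks_mulVec]
  simp only [Fintype.sum_sum_type, Sum.elim_inl, Sum.elim_inr, Matrix.zero_mulVec, add_zero,
    zero_add, mul_add]
  refine add_le_add (hA.trans ?_) (hB.trans ?_)
  · exact mul_le_mul_of_nonneg_right hA2 (by positivity)
  · exact mul_le_mul_of_nonneg_right hB2 (by positivity)

lemma l2_norm_kron_one_le {τ : Type*} [Fintype τ] [DecidableEq τ] (A : Matrix ι κ ℂ) :
    ‖Matrix.kronecker A (1 : Matrix τ τ ℂ)‖ ≤ ‖A‖ := by
  refine l2_norm_le _ (norm_nonneg _) fun x => ?_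
  have h : ∀ t : τ, ∑ i, ‖(A.mulVec fun j => x (j, t)) i‖ ^ 2 ≤
      ‖A‖ ^ 2 * ∑ j, ‖x (j, t)‖ ^ 2 := fun t => sq_norm_mulVec_le A _
  have h2 := Finset.sum_le_sum fun t (_ : t ∈ Finset.univ) => h t
  rw [← Finset.mul_sum] at h2
  rw [Fintype.sum_prod_type_right, Fintype.sum_prod_type_right]
  refine le_trans (le_of_eq ?_) h2
  refine Finset.sum_congr rfl fun t _ => Finset.sum_congr rfl fun i _ => ?_
  congr 2
  simp [Matrix.mulVec, dotProduct, Fintype.sum_prod_type, Matrix.kroneckerMap_apply,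
    Matrix.one_apply]

lemma l2_norm_col_le (x : ι → ℂ) {r : ℝ} (hr : 0 ≤ r) (h : ∑ i, ‖x i‖ ^ 2 ≤ r ^ 2) :
    ‖(Matrix.of fun (i : ι) (_ : Fin 1) => x i)‖ ≤ r := by
  refine l2_norm_le _ hr fun y => ?_
  simp only [Matrix.mulVec, dotProduct, Matrix.of_apply, Fin.sum_univ_one, norm_mul, mul_pow]
  rw [← Finset.sum_mul]
  exact mul_le_mul_of_nonneg_right h (by positivity)

lemma l2_norm_row_le [DecidableEq ι] (x : ι → ℂ) {r : ℝ} (hr : 0 ≤ r)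
    (h : ∑ i, ‖x i‖ ^ 2 ≤ r ^ 2) :
    ‖(Matrix.of fun (_ : Fin 1) (i : ι) => x i)‖ ≤ r := by
  have h1 := l2_norm_col_le (fun i => star (x i)) hr (by simpa using h)
  rw [← Matrix.l2_opNorm_conjTranspose] at h1
  convert h1 using 2
  ext i j
  simp [Matrix.conjTranspose_apply]

end ScalarMatrices

/-- The product `α v β` of a vector-valued matrix `v` with scalar matrices. -/
def sandwich {V : Type*} [AddCommGroup V] [Module ℂ V] {m n : ℕ}
    (α : Matrix (Fin n) (Fin m) ℂ) (v : Matrix (Fin m) (Fin m) V)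
    (β : Matrix (Fin m) (Fin n) ℂ) : Matrix (Fin n) (Fin n) V :=
  Matrix.of fun i j => ∑ k, ∑ l, (α i k * β l j) • v k l

/-- The block diagonal sum `v ⊕ w`. -/
def directSum {V : Type*} [AddCommGroup V] {m n : ℕ}
    (v : Matrix (Fin m) (Fin m) V) (w : Matrix (Fin n) (Fin n) V) :
    Matrix (Fin (m + n)) (Fin (m + n)) V :=
  Matrix.reindex finSumFinEquiv finSumFinEquiv (Matrix.fromBlocks v 0 0 w)

/-- An (abstract) operator space structure on a complex normed space: a norm on the `n × n`
matrices over `V` for each `n`, subject to Ruan's two axioms, that extends the given norm. -/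
structure OperatorSpaceStructure (V : Type*) [NormedAddCommGroup V] [NormedSpace ℂ V] where
  matNorm : (n : ℕ) → Matrix (Fin n) (Fin n) V → ℝ
  matNorm_one : ∀ v : V, matNorm 1 (Matrix.of fun _ _ => v) = ‖v‖
  add_le : ∀ (n : ℕ) (v w : Matrix (Fin n) (Fin n) V),
    matNorm n (v + w) ≤ matNorm n v + matNorm n w
  smul_eq : ∀ (n : ℕ) (c : ℂ) (v : Matrix (Fin n) (Fin n) V),
    matNorm n (c • v) = ‖c‖ * matNorm n v
  eq_zero : ∀ (n : ℕ) (v : Matrix (Fin n) (Fin n) V), matNorm n v = 0 → v = 0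
  directSum_eq : ∀ (m n : ℕ) (v : Matrix (Fin m) (Fin m) V) (w : Matrix (Fin n) (Fin n) V),
    matNorm (m + n) (directSum v w) = max (matNorm m v) (matNorm n w)
  sandwich_le : ∀ (m n : ℕ) (α : Matrix (Fin n) (Fin m) ℂ) (v : Matrix (Fin m) (Fin m) V)
    (β : Matrix (Fin m) (Fin n) ℂ), matNorm n (sandwich α v β) ≤ ‖α‖ * matNorm m v * ‖β‖

section Suprema

variable {V : Type*} [NormedAddCommGroup V] [NormedSpace ℂ V]

lemma norm_row_single_le {n : ℕ} (i : Fin n) :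
    ‖(Matrix.of fun (_ : Fin 1) (j : Fin n) => if j = i then (1 : ℂ) else 0)‖ ≤ 1 := by
  refine l2_norm_row_le _ zero_le_one (le_of_eq ?_)
  rw [Finset.sum_eq_single i] <;> simp +contextual

lemma norm_col_single_le {n : ℕ} (i : Fin n) :
    ‖(Matrix.of fun (j : Fin n) (_ : Fin 1) => if j = i then (1 : ℂ) else 0)‖ ≤ 1 := by
  refine l2_norm_col_le _ zero_le_one (le_of_eq ?_)
  rw [Finset.sum_eq_single i] <;> simp +contextual

/-- The supremum of a family of matrix seminorms that satisfy Ruan's axioms, provided that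
it gives back the norm of `V` on `1 × 1` matrices. -/
noncomputable def ofSup {T : Type*} [Nonempty T] (N : T → (n : ℕ) → Matrix (Fin n) (Fin n) V → ℝ)
    (h_nonneg : ∀ t n v, 0 ≤ N t n v)
    (h_add : ∀ t n v w, N t n (v + w) ≤ N t n v + N t n w)
    (h_smul : ∀ t n (c : ℂ) v, N t n (c • v) = ‖c‖ * N t n v)
    (h_sum : ∀ t m n (v : Matrix (Fin m) (Fin m) V) (w : Matrix (Fin n) (Fin n) V),
      N t (m + n) (directSum v w) ≤ max (N t m v) (N t n w))
    (h_sandwich : ∀ t m n (α : Matrix (Fin n) (Fin m) ℂ) (v : Matrix (Fin m) (Fin m) V)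
      (β : Matrix (Fin m) (Fin n) ℂ), N t n (sandwich α v β) ≤ ‖α‖ * N t m v * ‖β‖)
    (h_le : ∀ t v, N t 1 (Matrix.of fun _ _ => v) ≤ ‖v‖)
    (h_ge : ∀ v (C : ℝ), 0 ≤ C → (∀ t, N t 1 (Matrix.of fun _ _ => v) ≤ C) → ‖v‖ ≤ C) :
    OperatorSpaceStructure V := by
  have hbdd : ∀ n v, BddAbove (Set.range fun t => N t n v) := by
    intro n v
    refine ⟨∑ i, ∑ j, ‖v i j‖, ?_⟩
    rintro _ ⟨t, rfl⟩
    have hz : N t n 0 = 0 := by simpa using h_smul t n 0 0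
    have hs : ∀ (ι : Type) (s : Finset ι) (f : ι → Matrix (Fin n) (Fin n) V),
        N t n (∑ i ∈ s, f i) ≤ ∑ i ∈ s, N t n (f i) := fun ι s f =>
      Finset.le_sum_of_subadditive (N t n) hz.le (h_add t n) s f
    have hv : v = ∑ i, ∑ j, sandwich
        (Matrix.of fun (k : Fin n) (_ : Fin 1) => if k = i then (1 : ℂ) else 0)
        (Matrix.of fun _ _ => v i j)
        (Matrix.of fun (_ : Fin 1) (l : Fin n) => if l = j then (1 : ℂ) else 0) := by
      ext a b
      simp [Matrix.sum_apply, sandwich, ite_smul, Finset.sum_ite_eq]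
    conv_lhs => rw [hv]
    refine (hs _ _ _).trans (Finset.sum_le_sum fun i _ => (hs _ _ _).trans
      (Finset.sum_le_sum fun j _ => (h_sandwich t _ _ _ _ _).trans ?_))
    have h1 := norm_col_single_le i
    have h2 := norm_row_single_le j
    calc _ ≤ 1 * ‖v i j‖ * 1 := by
          refine mul_le_mul (mul_le_mul h1 (h_le t _) (h_nonneg _ _ _) zero_le_one) h2
            (norm_nonneg _) (by positivity)
      _ = _ := by ring
  have hle : ∀ n v t, N t n v ≤ ⨆ t, N t n v := fun n v t => le_ciSup (hbdd n v) t
  have hnn : ∀ n v, 0 ≤ ⨆ t, N t n v := fun n v => Real.iSup_nonneg fun t => h_nonneg t n v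
  have hsand : ∀ m n (α : Matrix (Fin n) (Fin m) ℂ) (v : Matrix (Fin m) (Fin m) V)
      (β : Matrix (Fin m) (Fin n) ℂ),
      (⨆ t, N t n (sandwich α v β)) ≤ ‖α‖ * (⨆ t, N t m v) * ‖β‖ := by
    intro m n α v β
    refine ciSup_le fun t => (h_sandwich t _ _ _ _ _).trans ?_
    gcongr
    exact hle m v t
  refine
    { matNorm := fun n v => ⨆ t, N t n v
      matNorm_one := fun v => le_antisymm (ciSup_le fun t => h_le t v)
        (h_ge v _ (hnn _ _) fun t => hle 1 _ t)
      add_le := fun n v w => ciSup_le fun t =>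
        (h_add t n v w).trans (add_le_add (hle n v t) (hle n w t))
      smul_eq := fun n c v => by
        simp only [h_smul]
        exact (Real.mul_iSup_of_nonneg (norm_nonneg c) _).symm
      eq_zero := ?_
      directSum_eq := ?_
      sandwich_le := hsand }
  · intro n v hv
    ext i j
    have h := hsand n 1 (Matrix.of fun (_ : Fin 1) (k : Fin n) => if k = i then (1 : ℂ) else 0) v
      (Matrix.of fun (k : Fin n) (_ : Fin 1) => if k = j then (1 : ℂ) else 0)
    have hs : sandwich (Matrix.of fun (_ : Fin 1) (k : Fin n) => if k = i then (1 : ℂ) else 0) v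
      (Matrix.of fun (k : Fin n) (_ : Fin 1) => if k = j then (1 : ℂ) else 0) =
        Matrix.of fun _ _ => v i j := by
      ext a b
      simp [sandwich, ite_smul, Finset.sum_ite_eq]
    rw [hv, hs, mul_zero, zero_mul] at h
    exact norm_le_zero_iff.1 (h_ge _ 0 le_rfl fun t => (hle 1 _ t).trans h)
  · intro m n v w
    refine le_antisymm (ciSup_le fun t => (h_sum t m n v w).trans
      (max_le_max (hle m v t) (hle n w t))) (max_le ?_ ?_)
    · have h := hsand (m + n) m
        (Matrix.of fun i k => if k = Fin.castAdd n i then (1 : ℂ) else 0) (directSum v w)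
        (Matrix.of fun k i => if k = Fin.castAdd n i then (1 : ℂ) else 0)
      have hs : sandwich
          (Matrix.of fun i k => if k = Fin.castAdd n i then (1 : ℂ) else 0) (directSum v w)
          (Matrix.of fun k i => if k = Fin.castAdd n i then (1 : ℂ) else 0) = v := by
        ext a b
        simp [sandwich, directSum, ite_smul]
      have h1 : ‖(Matrix.of fun (i : Fin m) (k : Fin (m + n)) =>
          if k = Fin.castAdd n i then (1 : ℂ) else 0)‖ ≤ 1 := by
        refine l2_norm_le _ zero_le_one fun x => ?_
        simp [Matrix.mulVec, dotProduct, Fin.sum_univ_add]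
        positivity
      have h2 : ‖(Matrix.of fun (k : Fin (m + n)) (i : Fin m) =>
          if k = Fin.castAdd n i then (1 : ℂ) else 0)‖ ≤ 1 := by
        rw [← Matrix.l2_opNorm_conjTranspose]
        refine le_trans (le_of_eq ?_) h1
        congr 1
        ext i k
        simp [Matrix.conjTranspose_apply, apply_ite]
      rw [hs] at h
      refine h.trans ?_
      calc _ ≤ 1 * (⨆ t, N t (m + n) (directSum v w)) * 1 :=
            mul_le_mul (mul_le_mul_of_nonneg_right h1 (hnn _ _)) h2 (norm_nonneg _)
              (by simpa using hnn _ _)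
        _ = _ := by ring
    · have h := hsand (m + n) n
        (Matrix.of fun i k => if k = Fin.natAdd m i then (1 : ℂ) else 0) (directSum v w)
        (Matrix.of fun k i => if k = Fin.natAdd m i then (1 : ℂ) else 0)
      have hs : sandwich
          (Matrix.of fun i k => if k = Fin.natAdd m i then (1 : ℂ) else 0) (directSum v w)
          (Matrix.of fun k i => if k = Fin.natAdd m i then (1 : ℂ) else 0) = w := by
        ext a b
        simp [sandwich, directSum, ite_smul]
      have h1 : ‖(Matrix.of fun (i : Fin n) (k : Fin (m + n)) =>
          if k = Fin.natAdd m i then (1 : ℂ) else 0)‖ ≤ 1 := by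
        refine l2_norm_le _ zero_le_one fun x => ?_
        simp [Matrix.mulVec, dotProduct, Fin.sum_univ_add]
        positivity
      have h2 : ‖(Matrix.of fun (k : Fin (m + n)) (i : Fin n) =>
          if k = Fin.natAdd m i then (1 : ℂ) else 0)‖ ≤ 1 := by
        rw [← Matrix.l2_opNorm_conjTranspose]
        refine le_trans (le_of_eq ?_) h1
        congr 1
        ext i k
        simp [Matrix.conjTranspose_apply, apply_ite]
      rw [hs] at h
      refine h.trans ?_
      calc _ ≤ 1 * (⨆ t, N t (m + n) (directSum v w)) * 1 :=
            mul_le_mul (mul_le_mul_of_nonneg_right h1 (hnn _ _)) h2 (norm_nonneg _)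
              (by simpa using hnn _ _)
        _ = _ := by ring

end Suprema

/-- The minimal operator space `min V`: the norm of `[v i j]` is the supremum of the norms
of the scalar matrices `[f (v i j)]` over the functionals `f` of norm at most one. -/
noncomputable def minStructure (V : Type*) [NormedAddCommGroup V] [NormedSpace ℂ V] :
    OperatorSpaceStructure V :=
  haveI : Nonempty {f : StrongDual ℂ V // ‖f‖ ≤ 1} := ⟨⟨0, by simp⟩⟩
  ofSup (T := {f : StrongDual ℂ V // ‖f‖ ≤ 1})
    (fun f n v => ‖(Matrix.of fun i j => f.1 (v i j) : Matrix (Fin n) (Fin n) ℂ)‖)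
    (fun _ _ _ => norm_nonneg _)
    (fun f n v w => by
      refine le_trans (le_of_eq ?_) (norm_add_le _ _)
      congr 1; ext i j; simp)
    (fun f n c v => by
      rw [← norm_smul]
      congr 1; ext i j; simp)
    (fun f m n v w => by
      refine le_trans (le_of_eq ?_) ((l2_norm_reindex_le finSumFinEquiv finSumFinEquiv _).trans
        (l2_norm_fromBlocks_le _ _))
      congr 1; ext i j
      refine Fin.addCases (fun i => ?_) (fun i => ?_) i <;>
      refine Fin.addCases (fun j => ?_) (fun j => ?_) j <;> simp [directSum])
    (fun f m n α v β => by
      refine le_trans (le_of_eq ?_) ((Matrix.l2_opNorm_mul _ _).trans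
        (mul_le_mul_of_nonneg_right (Matrix.l2_opNorm_mul _ _) (norm_nonneg _)))
      congr 1; ext i j
      simp only [sandwich, Matrix.of_apply, map_sum, map_smul, Matrix.mul_apply, smul_eq_mul,
        Finset.sum_mul]
      rw [Finset.sum_comm]
      exact Finset.sum_congr rfl fun _ _ => Finset.sum_congr rfl fun _ _ => by ring)
    (fun f v => by
      refine l2_norm_le _ (norm_nonneg _) fun x => ?_
      have h : ‖f.1 v‖ ≤ ‖v‖ := (f.1.le_opNorm v).trans
        (mul_le_of_le_one_left (norm_nonneg _) f.2)
      simp only [Matrix.mulVec, dotProduct, Matrix.of_apply, Fin.sum_univ_one, norm_mul, mul_pow]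
      gcongr)
    (fun v C hC h => by
      obtain ⟨g, hg, hgv⟩ := exists_dual_vector'' ℂ v
      have h1 := sq_norm_mulVec_le
        (Matrix.of fun _ _ => g v : Matrix (Fin 1) (Fin 1) ℂ) (fun _ => 1)
      have h2 := h ⟨g, hg⟩
      simp [Matrix.mulVec, dotProduct, hgv] at h1
      exact (le_of_abs_le (abs_le_of_sq_le_sq h1 (norm_nonneg _))).trans
        (le_trans (le_of_eq (by congr 1; ext i j; simp [hgv])) h2))

lemma minStructure_matNorm (V : Type*) [NormedAddCommGroup V] [NormedSpace ℂ V] (n : ℕ)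
    (v : Matrix (Fin n) (Fin n) V) :
    (minStructure V).matNorm n v = ⨆ f : {f : StrongDual ℂ V // ‖f‖ ≤ 1},
      ‖(Matrix.of fun i j => f.1 (v i j) : Matrix (Fin n) (Fin n) ℂ)‖ := rfl

namespace OperatorSpaceStructure

variable {V : Type*} [NormedAddCommGroup V] [NormedSpace ℂ V]

lemma matNorm_nonneg (X : OperatorSpaceStructure V) (n : ℕ) (v : Matrix (Fin n) (Fin n) V) :
    0 ≤ X.matNorm n v := by
  have h := X.add_le n v (-v)
  have h0 : X.matNorm n 0 = 0 := by simpa using X.smul_eq n 0 0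
  have h1 : X.matNorm n (-v) = X.matNorm n v := by simpa using X.smul_eq n (-1) v
  rw [add_neg_cancel, h0, h1] at h
  linarith

/-- A bounded functional is completely bounded with the same norm. -/
lemma norm_functional_le (X : OperatorSpaceStructure V) (f : StrongDual ℂ V) (m : ℕ)
    (x : Matrix (Fin m) (Fin m) V) :
    ‖(Matrix.of fun k l => f (x k l) : Matrix (Fin m) (Fin m) ℂ)‖ ≤ ‖f‖ * X.matNorm m x := by
  have hx := X.matNorm_nonneg m x
  refine l2_norm_le _ (by positivity) fun ξ => ?_
  set y := (Matrix.of fun k l => f (x k l) : Matrix (Fin m) (Fin m) ℂ).mulVec ξ with hy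
  set a := √(∑ i, ‖y i‖ ^ 2) with ha
  set b := √(∑ i, ‖ξ i‖ ^ 2) with hb
  have ha2 : a ^ 2 = ∑ i, ‖y i‖ ^ 2 := Real.sq_sqrt (by positivity)
  have hb2 : b ^ 2 = ∑ i, ‖ξ i‖ ^ 2 := Real.sq_sqrt (by positivity)
  have ha0 : 0 ≤ a := Real.sqrt_nonneg _
  have hb0 : 0 ≤ b := Real.sqrt_nonneg _
  have hs := X.sandwich_le m 1 (Matrix.of fun (_ : Fin 1) k => star (y k)) x
    (Matrix.of fun k (_ : Fin 1) => ξ k)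
  have h1 := l2_norm_row_le (fun k => star (y k)) ha0 (by simp [ha2])
  have h2 := l2_norm_col_le ξ hb0 hb2.ge
  have hw : sandwich (Matrix.of fun (_ : Fin 1) k => star (y k)) x
      (Matrix.of fun k (_ : Fin 1) => ξ k) =
      Matrix.of fun _ _ => ∑ k, ∑ l, (star (y k) * ξ l) • x k l := by
    ext i j; simp [sandwich]
  rw [hw, X.matNorm_one] at hs
  have hf : f (∑ k, ∑ l, (star (y k) * ξ l) • x k l) = ((a ^ 2 : ℝ) : ℂ) := by
    rw [ha2]
    simp only [map_sum, map_smul, smul_eq_mul]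
    push_cast
    refine Finset.sum_congr rfl fun k _ => ?_
    rw [← Complex.conj_mul', starRingEnd_apply]
    conv_rhs => rw [hy]
    simp only [Matrix.mulVec, dotProduct, Matrix.of_apply, Finset.mul_sum]
    refine Finset.sum_congr rfl fun l _ => ?_
    rw [hy]
    simp only [Matrix.mulVec, dotProduct, Matrix.of_apply]
    ring
  have h3 := f.le_opNorm (∑ k, ∑ l, (star (y k) * ξ l) • x k l)
  rw [hf, Complex.norm_real, Real.norm_of_nonneg (by positivity)] at h3
  have h4 : a ^ 2 ≤ ‖f‖ * (a * X.matNorm m x * b) :=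
    h3.trans (mul_le_mul_of_nonneg_left (hs.trans
      (mul_le_mul (mul_le_mul_of_nonneg_right h1 hx) h2 (norm_nonneg _) (by positivity)))
      (norm_nonneg _))
  have h5 : a ≤ ‖f‖ * X.matNorm m x * b := by
    rcases ha0.eq_or_lt with h | h
    · rw [← h]; positivity
    · refine le_of_mul_le_mul_left ?_ h
      nlinarith
  rw [← ha2, ← hb2, ← mul_pow]
  exact pow_le_pow_left₀ ha0 h5 2

/-- The dual operator space: the norm of a matrix `[φ i j]` of functionals is the completely
bounded norm of the map `v ↦ [φ i j v]`, that is, the supremum of the norms of the scalar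
matrices `[φ i j (x k l)]` over all matrices `x` over `V` of norm at most one. -/
noncomputable def dual (X : OperatorSpaceStructure V) :
    OperatorSpaceStructure (StrongDual ℂ V) :=
  haveI : Nonempty {p : Σ m : ℕ, Matrix (Fin m) (Fin m) V // X.matNorm p.1 p.2 ≤ 1} :=
    ⟨⟨⟨0, 0⟩, by simpa using (X.smul_eq 0 0 0).trans_le (by simp)⟩⟩
  ofSup (T := {p : Σ m : ℕ, Matrix (Fin m) (Fin m) V // X.matNorm p.1 p.2 ≤ 1})
    (fun p n φ => ‖(Matrix.of fun s t => φ s.1 t.1 (p.1.2 s.2 t.2) :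
      Matrix (Fin n × Fin p.1.1) (Fin n × Fin p.1.1) ℂ)‖)
    (fun _ _ _ => norm_nonneg _)
    (fun p n v w => by
      refine le_trans (le_of_eq ?_) (norm_add_le _ _)
      congr 1)
    (fun p n c v => by
      rw [← norm_smul]
      congr 1)
    (fun p m n v w => by
      refine le_trans (le_of_eq ?_) ((l2_norm_reindex_le
        ((Equiv.sumProdDistrib _ _ _).symm.trans (Equiv.prodCongr finSumFinEquiv (Equiv.refl _)))
        ((Equiv.sumProdDistrib _ _ _).symm.trans (Equiv.prodCongr finSumFinEquiv (Equiv.refl _)))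
        _).trans (l2_norm_fromBlocks_le _ _))
      congr 1; ext ⟨i, k⟩ ⟨j, l⟩
      refine Fin.addCases (fun i => ?_) (fun i => ?_) i <;>
      refine Fin.addCases (fun j => ?_) (fun j => ?_) j <;> simp [directSum])
    (fun p m n α v β => by
      have h1 := l2_norm_kron_one_le (τ := Fin p.1.1) α
      have h2 := l2_norm_kron_one_le (τ := Fin p.1.1) β
      refine le_trans (le_of_eq ?_) ((Matrix.l2_opNorm_mul _ _).trans
        (mul_le_mul ((Matrix.l2_opNorm_mul _ _).trans
          (mul_le_mul_of_nonneg_right h1 (norm_nonneg _))) h2 (norm_nonneg _) (by positivity)))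
      congr 1; ext ⟨i, k⟩ ⟨j, l⟩
      simp only [sandwich, Matrix.of_apply, Matrix.mul_apply, Fintype.sum_prod_type,
        Finset.sum_mul, Matrix.kronecker, Matrix.kroneckerMap_apply, Matrix.one_apply,
        sum_apply, smul_apply, smul_eq_mul]
      simp only [mul_ite, mul_one, mul_zero, ite_mul, zero_mul, Finset.sum_ite_eq,
        Finset.sum_ite_eq', Finset.mem_univ, if_true, Finset.sum_const_zero]
      rw [Finset.sum_comm]
      simp [mul_right_comm])
    (fun p f => by
      have h := X.norm_functional_le f p.1.1 p.1.2
      refine le_trans (le_trans (le_of_eq ?_) (l2_norm_reindex_le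
        (Equiv.uniqueProd (Fin p.1.1) (Fin 1)).symm
        (Equiv.uniqueProd (Fin p.1.1) (Fin 1)).symm _))
        (h.trans (mul_le_of_le_one_right (norm_nonneg _) p.2))
      congr 1)
    (fun f C hC h => by
      refine ContinuousLinearMap.opNorm_le_of_unit_norm hC fun x hx => ?_
      have h1 := h ⟨⟨1, Matrix.of fun _ _ => x⟩, by rw [X.matNorm_one]; exact hx.le⟩
      have h2 := sq_norm_mulVec_le (Matrix.of fun _ _ => f x :
        Matrix (Fin 1 × Fin 1) (Fin 1 × Fin 1) ℂ) (fun _ => 1)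
      simp [Matrix.mulVec, dotProduct] at h2
      exact (le_of_abs_le (abs_le_of_sq_le_sq h2 (norm_nonneg _))).trans h1)

lemma dual_matNorm (X : OperatorSpaceStructure V) (n : ℕ)
    (φ : Matrix (Fin n) (Fin n) (StrongDual ℂ V)) :
    X.dual.matNorm n φ = ⨆ p : {p : Σ m : ℕ, Matrix (Fin m) (Fin m) V // X.matNorm p.1 p.2 ≤ 1},
      ‖(Matrix.of fun s t => φ s.1 t.1 (p.1.2 s.2 t.2) :
        Matrix (Fin n × Fin p.1.1) (Fin n × Fin p.1.1) ℂ)‖ := rfl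

end OperatorSpaceStructure

section Maps

variable {V W Z : Type*} [NormedAddCommGroup V] [NormedSpace ℂ V] [NormedAddCommGroup W]
  [NormedSpace ℂ W] [NormedAddCommGroup Z] [NormedSpace ℂ Z]

/-- Complete boundedness of a linear map: its amplifications are uniformly bounded. -/
def CompletelyBounded (X : OperatorSpaceStructure V) (Y : OperatorSpaceStructure W)
    (T : V →ₗ[ℂ] W) : Prop :=
  ∃ C : ℝ, ∀ (n : ℕ) (v : Matrix (Fin n) (Fin n) V),
    Y.matNorm n (v.map T) ≤ C * X.matNorm n v

/-- (Joint) complete boundedness of a bilinear map: `‖[u (v i j) (w k l)]‖ ≤ C ‖v‖ ‖w‖` for all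
matrices `v` and `w`, the matrix on the left being indexed by pairs. -/
def CompletelyBoundedBilinear (X : OperatorSpaceStructure V) (Y : OperatorSpaceStructure W)
    (S : OperatorSpaceStructure Z) (u : V →ₗ[ℂ] W →ₗ[ℂ] Z) : Prop :=
  ∃ C : ℝ, ∀ (m n : ℕ) (v : Matrix (Fin m) (Fin m) V) (w : Matrix (Fin n) (Fin n) W),
    S.matNorm (m * n) (Matrix.reindex finProdFinEquiv finProdFinEquiv
      (Matrix.of fun p q => u (v p.1 q.1) (w p.2 q.2))) ≤ C * X.matNorm m v * Y.matNorm n w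

end Maps

section Amenability

variable {A : Type*} [NonUnitalNormedRing A] [NormedSpace ℂ A]

/-- An operator `A`-bimodule: `left a x = a · x` and `right a x = x · a`. The algebra need not
have a unit. -/
structure OperatorBimodule (X : OperatorSpaceStructure A) {E : Type*} [NormedAddCommGroup E]
    [NormedSpace ℂ E] (Y : OperatorSpaceStructure E) where
  left : A →ₗ[ℂ] E →ₗ[ℂ] E
  right : A →ₗ[ℂ] E →ₗ[ℂ] E
  left_mul : ∀ a b x, left (a * b) x = left a (left b x)
  right_mul : ∀ a b x, right (a * b) x = right b (right a x)
  left_right : ∀ a b x, left a (right b x) = right b (left a x)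
  left_cb : CompletelyBoundedBilinear X Y Y left
  right_cb : CompletelyBoundedBilinear X Y Y right

variable {X : OperatorSpaceStructure A} {E : Type*} [NormedAddCommGroup E]
  [NormedSpace ℂ E] {Y : OperatorSpaceStructure E}

/-- `D (a b) = a · D b + D a · b`, where the dual space carries the module actions
`(a · φ) x = φ (x · a)` and `(φ · a) x = φ (a · x)`. -/
def OperatorBimodule.IsDerivation (M : OperatorBimodule X Y) (D : A →ₗ[ℂ] StrongDual ℂ E) :
    Prop :=
  ∀ a b x, D (a * b) x = D b (M.right a x) + D a (M.left b x)

/-- `D a = a · φ - φ · a` for some `φ` in the dual space. -/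
def OperatorBimodule.IsInner (M : OperatorBimodule X Y) (D : A →ₗ[ℂ] StrongDual ℂ E) : Prop :=
  ∃ φ : StrongDual ℂ E, ∀ a x, D a x = φ (M.right a x) - φ (M.left a x)

end Amenability

/-- Operator amenability of a Banach algebra with a given operator space structure: every
completely bounded derivation into the dual of a complete operator bimodule is inner. -/
def OperatorAmenable {A : Type u} [NonUnitalNormedRing A] [NormedSpace ℂ A]
    [IsScalarTower ℂ A A] [SMulCommClass ℂ A A] (X : OperatorSpaceStructure A) : Prop :=
  ∀ (E : Type u) [NormedAddCommGroup E] [NormedSpace ℂ E] [CompleteSpace E]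
    (Y : OperatorSpaceStructure E) (M : OperatorBimodule X Y) (D : A →ₗ[ℂ] StrongDual ℂ E),
    CompletelyBounded X Y.dual D → M.IsDerivation D → M.IsInner D

/-- A subalgebra of a complex normed algebra with the restricted norm. -/
instance subalgebraNormedSpace {B : Type*} [NonUnitalNormedRing B] [NormedSpace ℂ B]
    (A : NonUnitalSubalgebra ℂ B) : NormedSpace ℂ A where
  norm_smul_le c x := norm_smul_le c (x : B)

end OpSp

/-! Realise 𝔄 isometrically in `C(Ω, ℂ)`, with Ω the character space of the unitization of the
ambient algebra, and let `W` be the span of 𝔄 and the constants. If the conjugate of some `a` in 𝔄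
were outside the closure of `W`, Hahn-Banach would give a functional `l` that kills `W` but not
`star a`.

Hilbert space enters through the little Grothendieck inequality for functionals: a separation
argument produces a positive φ with `|l b|² ≤ φ (star b * b)` (`exists_positive_dominating`). Hence
`l` is continuous for the norm of the GNS space of φ. There 𝔄 acts by normal operators, and the
action is completely contractive, because at each point it is a scalar matrix inequality and bounded
functionals are automatically completely bounded with the same norm. The closure `K` of the image of
`W` is an invariant subspace.

Amenability makes `K` reducing. With `P` the projection onto `K`, the derivation `a ↦ π a P - P π a`
takes values in the operators that kill `K` and have range in `K`. It is therefore a derivation into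
the bidual of that corner, and being inner there it is implemented by an operator `T` of the same
kind; `P - T` is an idempotent onto `K` that commutes with 𝔄 (`OperatorAmenable.exists_idempotent`).
By Fuglede's theorem it also commutes with the adjoints, so these preserve `K`
(`OperatorAmenable.adjoint_mem`). Applied to the vector of `1` this puts `star a` in `K`, a limit of
elements of `W` in the GNS norm, so `l (star a) = 0`, a contradiction.

Finally `W` is already closed, and comparing components in the unitization removes the constant. -/

namespace OpSp

open scoped InnerProductSpace

/-! ### Matrices of operators on Hilbert sums, and concrete operator spaces. -/

section OperatorMatrices

variable {H : Type*} [NormedAddCommGroup H] [InnerProductSpace ℂ H] {ι κ : Type*} [Fintype ι]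
  [Fintype κ]

/-- In an orthonormal basis the inequality splits into one scalar inequality per coordinate. The
general case follows by restricting to the span of the finitely many vectors. -/
lemma sq_norm_sum_smul_le_of_finiteDimensional [DecidableEq κ] [FiniteDimensional ℂ H]
    (α : Matrix ι κ ℂ) (y : κ → H) :
    ∑ i, ‖∑ k, α i k • y k‖ ^ 2 ≤ ‖α‖ ^ 2 * ∑ k, ‖y k‖ ^ 2 := by
  set b := stdOrthonormalBasis ℂ H
  simp only [← b.sum_sq_norm_inner_right]
  rw [Finset.sum_comm, Finset.sum_comm (s := (Finset.univ : Finset κ)), Finset.mul_sum]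
  refine Finset.sum_le_sum fun s _ => ?_
  simpa [Matrix.mulVec, dotProduct, inner_sum, inner_smul_right] using
    sq_norm_mulVec_le α fun k => ⟪b s, y k⟫_ℂ

/-- A scalar matrix acts on vectors in a Hilbert space with its operator norm. -/
lemma sq_norm_sum_smul_le [DecidableEq κ] (α : Matrix ι κ ℂ) (y : κ → H) :
    ∑ i, ‖∑ k, α i k • y k‖ ^ 2 ≤ ‖α‖ ^ 2 * ∑ k, ‖y k‖ ^ 2 := by
  have : FiniteDimensional ℂ (Submodule.span ℂ (Set.range y)) :=
    FiniteDimensional.span_of_finite ℂ (Set.finite_range y)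
  have h := sq_norm_sum_smul_le_of_finiteDimensional α fun k =>
    (⟨y k, Submodule.subset_span ⟨k, rfl⟩⟩ : Submodule.span ℂ (Set.range y))
  simpa only [Submodule.coe_norm, Submodule.coe_smul, Submodule.coe_sum] using h

/-- The operator on the Hilbert sum of copies of `H` given by a matrix of operators. -/
noncomputable def matOp (v : Matrix ι ι (H →L[ℂ] H)) :
    PiLp 2 (fun _ : ι => H) →L[ℂ] PiLp 2 (fun _ : ι => H) :=
  (PiLp.continuousLinearEquiv 2 ℂ fun _ : ι => H).symm.toContinuousLinearMap ∘L
    (ContinuousLinearMap.pi fun i => ∑ j, v i j ∘L ContinuousLinearMap.proj j) ∘L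
    (PiLp.continuousLinearEquiv 2 ℂ fun _ : ι => H).toContinuousLinearMap

lemma matOp_apply (v : Matrix ι ι (H →L[ℂ] H)) (x : PiLp 2 (fun _ : ι => H)) (i : ι) :
    matOp v x i = ∑ j, v i j (x j) := by
  simp [matOp]

lemma sq_norm_sum_apply_le (v : Matrix ι ι (H →L[ℂ] H)) (x : ι → H) :
    ∑ i, ‖∑ j, v i j (x j)‖ ^ 2 ≤ ‖matOp v‖ ^ 2 * ∑ j, ‖x j‖ ^ 2 := by
  have h := pow_le_pow_left₀ (norm_nonneg _) ((matOp v).le_opNorm (WithLp.toLp 2 x)) 2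
  rw [mul_pow, PiLp.norm_sq_eq_of_L2, PiLp.norm_sq_eq_of_L2] at h
  simpa only [matOp_apply] using h

lemma norm_matOp_le (v : Matrix ι ι (H →L[ℂ] H)) {C : ℝ} (hC : 0 ≤ C)
    (h : ∀ x : ι → H, ∑ i, ‖∑ j, v i j (x j)‖ ^ 2 ≤ C ^ 2 * ∑ j, ‖x j‖ ^ 2) :
    ‖matOp v‖ ≤ C := by
  refine ContinuousLinearMap.opNorm_le_bound _ hC fun x => ?_
  refine (sq_le_sq₀ (norm_nonneg _) (by positivity)).1 ?_
  rw [mul_pow, PiLp.norm_sq_eq_of_L2, PiLp.norm_sq_eq_of_L2]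
  simpa only [matOp_apply] using h x

lemma norm_matOp_le_of_equiv (v : Matrix ι ι (H →L[ℂ] H)) {C : ℝ} (hC : 0 ≤ C) (e : ι ≃ κ)
    (h : ∀ x : ι → H, ∑ i, ‖∑ j, v i j (x j)‖ ^ 2 ≤ C ^ 2 * ∑ j, ‖x j‖ ^ 2) :
    ‖matOp (Matrix.reindex e e v)‖ ≤ C := by
  refine norm_matOp_le _ hC fun x => ?_
  have h1 := h (x ∘ e)
  simp only [Function.comp] at h1
  rw [Equiv.sum_comp e fun j => ‖x j‖ ^ 2] at h1
  refine le_trans (le_of_eq ?_) h1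
  rw [← Equiv.sum_comp e]
  refine Finset.sum_congr rfl fun i _ => ?_
  rw [← Equiv.sum_comp e]
  simp

/-- If `v` and `w` are bounded on Hilbert sums, then so is `[v i j ∘ w k l]`. -/
lemma sq_norm_sum_comp_le (v : Matrix ι ι (H →L[ℂ] H)) (w : Matrix κ κ (H →L[ℂ] H)) {C D : ℝ}
    (hv : ∀ x : ι → H, ∑ i, ‖∑ j, v i j (x j)‖ ^ 2 ≤ C ^ 2 * ∑ j, ‖x j‖ ^ 2)
    (hw : ∀ x : κ → H, ∑ i, ‖∑ j, w i j (x j)‖ ^ 2 ≤ D ^ 2 * ∑ j, ‖x j‖ ^ 2) (x : ι × κ → H) :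
    ∑ s : ι × κ, ‖∑ t : ι × κ, (v s.1 t.1 * w s.2 t.2) (x t)‖ ^ 2 ≤
      (C * D) ^ 2 * ∑ t, ‖x t‖ ^ 2 := by
  -- The matrix factors as `(v ⊗ 1)(1 ⊗ w)`: the bound for `w` is used for each fixed `j`, the bound
  -- for `v` for each fixed `k`.
  calc ∑ s : ι × κ, ‖∑ t : ι × κ, (v s.1 t.1 * w s.2 t.2) (x t)‖ ^ 2
      = ∑ k, ∑ i, ‖∑ j, v i j (∑ l, w k l (x (j, l)))‖ ^ 2 := by
        simp [Fintype.sum_prod_type_right (f := fun s : ι × κ => ‖_‖ ^ 2), Fintype.sum_prod_type,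
          map_sum]
    _ ≤ ∑ k, C ^ 2 * ∑ j, ‖∑ l, w k l (x (j, l))‖ ^ 2 := Finset.sum_le_sum fun k _ => hv _
    _ = C ^ 2 * ∑ j, ∑ k, ‖∑ l, w k l (x (j, l))‖ ^ 2 := by
        rw [← Finset.mul_sum, Finset.sum_comm]
    _ ≤ C ^ 2 * ∑ j, D ^ 2 * ∑ l, ‖x (j, l)‖ ^ 2 := by
        gcongr with j
        exact hw _
    _ = _ := by rw [← Finset.mul_sum, Fintype.sum_prod_type]; ring

/-- A space of operators on a Hilbert space is an operator space. -/
noncomputable def concreteStructure {V : Type*} [NormedAddCommGroup V] [NormedSpace ℂ V]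
    (j : V →ₗᵢ[ℂ] H →L[ℂ] H) : OperatorSpaceStructure V where
  matNorm n v := ‖matOp (v.map j)‖
  matNorm_one v := by
    refine le_antisymm ((norm_matOp_le _ (norm_nonneg _) fun x => ?_).trans_eq (j.norm_map v))
      ((j.norm_map v).symm.trans_le <| ContinuousLinearMap.opNorm_le_bound _
        (ContinuousLinearMap.opNorm_nonneg _) fun x => ?_)
    · simpa [← mul_pow] using
        pow_le_pow_left₀ (norm_nonneg _) ((j v).le_opNorm (x 0)) 2
    · have h := sq_norm_sum_apply_le
        ((Matrix.of fun _ _ => v : Matrix (Fin 1) (Fin 1) V).map j) fun _ => x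
      simp only [Fin.sum_univ_one, ← mul_pow] at h
      exact (sq_le_sq₀ (norm_nonneg _) (mul_nonneg (ContinuousLinearMap.opNorm_nonneg _)
        (norm_nonneg _))).1 h
  add_le n v w := by
    refine le_trans (le_of_eq ?_) (ContinuousLinearMap.opNorm_add_le _ _)
    congr 1
    ext x i
    simp [matOp_apply, Finset.sum_add_distrib]
  smul_eq n c v := by
    have hs : ∀ (c : ℂ) (v : Matrix (Fin n) (Fin n) V),
        ‖matOp ((c • v).map j)‖ ≤ ‖c‖ * ‖matOp (v.map j)‖ := fun c v => by
      refine le_trans (le_of_eq ?_) (ContinuousLinearMap.opNorm_smul_le _ _)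
      congr 1
      ext x i
      simp [matOp_apply, Finset.smul_sum]
    refine le_antisymm (hs c v) ?_
    rcases eq_or_ne c 0 with rfl | hc
    · simpa using ContinuousLinearMap.opNorm_nonneg _
    · have h := hs c⁻¹ (c • v)
      rwa [inv_smul_smul₀ hc, norm_inv, ← div_eq_inv_mul,
        le_div_iff₀' (norm_pos_iff.2 hc)] at h
  eq_zero n v h := by
    ext i k
    refine j.injective ?_
    ext x
    -- A vector supported in slot `k` isolates the `k`-th column.
    have h1 := sq_norm_sum_apply_le (v.map j) (Pi.single k x)
    rw [h, zero_pow two_ne_zero, zero_mul] at h1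
    have h2 := (Finset.sum_eq_zero_iff_of_nonneg fun _ _ => by positivity).1
      (le_antisymm h1 (by positivity)) i (Finset.mem_univ i)
    rw [sq_eq_zero_iff, norm_eq_zero, Finset.sum_eq_single k (by simp +contextual)
      (by simp)] at h2
    simpa using h2
  directSum_eq m n v w := by
    have hv := sq_norm_sum_apply_le (v.map j)
    have hw := sq_norm_sum_apply_le (w.map j)
    have hd := sq_norm_sum_apply_le ((directSum v w).map j)
    refine le_antisymm (norm_matOp_le _
      (le_max_of_le_left (ContinuousLinearMap.opNorm_nonneg _)) fun x => ?_)
      (max_le (norm_matOp_le _ (ContinuousLinearMap.opNorm_nonneg _) fun x => ?_)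
        (norm_matOp_le _ (ContinuousLinearMap.opNorm_nonneg _) fun x => ?_))
    · have h1 := hv fun i => x (Fin.castAdd n i)
      have h2 := hw fun i => x (Fin.natAdd m i)
      simp only [Fin.sum_univ_add, mul_add]
      refine add_le_add (le_trans (le_of_eq ?_) (h1.trans ?_))
        (le_trans (le_of_eq ?_) (h2.trans ?_))
      · simp [directSum]
      · gcongr
        exact le_max_left _ _
      · simp [directSum]
      · gcongr
        exact le_max_right _ _
    -- Padding with zeros recovers each summand as a compression of the direct sum.
    · have h := hd (Fin.append x 0)
      simp only [Fin.sum_univ_add] at h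
      simpa [directSum] using h
    · have h := hd (Fin.append 0 x)
      simp only [Fin.sum_univ_add] at h
      simpa [directSum] using h
  sandwich_le m n α v β := by
    refine norm_matOp_le _ (mul_nonneg (mul_nonneg (norm_nonneg _)
      (ContinuousLinearMap.opNorm_nonneg _)) (norm_nonneg _)) fun x => ?_
    have h1 := sq_norm_sum_smul_le β x
    have h2 := sq_norm_sum_apply_le (v.map j) fun l => ∑ q, β l q • x q
    have h3 := sq_norm_sum_smul_le α fun k =>
      ∑ l, (v.map j) k l (∑ q, β l q • x q)
    calc _ = ∑ i, ‖∑ k, α i k • ∑ l, (v.map j) k l (∑ q, β l q • x q)‖ ^ 2 := by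
          refine Finset.sum_congr rfl fun i _ => ?_
          congr 2
          simp only [sandwich, Matrix.map_apply, Matrix.of_apply, map_sum, map_smul,
            sum_apply, smul_apply, Finset.smul_sum,
            smul_smul]
          rw [Finset.sum_comm]
          refine Finset.sum_congr rfl fun k _ => ?_
          rw [Finset.sum_comm]
      _ ≤ ‖α‖ ^ 2 * (‖matOp (v.map j)‖ ^ 2 * (‖β‖ ^ 2 * ∑ j, ‖x j‖ ^ 2)) := by
          refine h3.trans ?_
          gcongr
          refine h2.trans ?_
          gcongr
      _ = _ := by ring

lemma concreteStructure_matNorm {V : Type*} [NormedAddCommGroup V] [NormedSpace ℂ V]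
    (j : V →ₗᵢ[ℂ] H →L[ℂ] H) (n : ℕ)
    (v : Matrix (Fin n) (Fin n) V) :
    (concreteStructure j).matNorm n v = ‖matOp (v.map j)‖ := rfl

end OperatorMatrices

/-! ### The matrix pairing of an operator space with its dual. -/

namespace OperatorSpaceStructure

variable {V : Type*} [NormedAddCommGroup V] [NormedSpace ℂ V]

/-- A crude bound, from splitting `φ` into matrix units. It serves to show that the supremum
defining the dual norm is over a bounded set, without which a real `⨆` would not dominate its terms.
-/
lemma norm_pairing_le_sum (X : OperatorSpaceStructure V) {n m : ℕ}
    (φ : Matrix (Fin n) (Fin n) (StrongDual ℂ V)) (x : Matrix (Fin m) (Fin m) V) :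
    ‖(Matrix.of fun s t => φ s.1 t.1 (x s.2 t.2) :
      Matrix (Fin n × Fin m) (Fin n × Fin m) ℂ)‖ ≤ ∑ i, ∑ j, ‖φ i j‖ * X.matNorm m x := by
  have h : (Matrix.of fun s t => φ s.1 t.1 (x s.2 t.2) :
      Matrix (Fin n × Fin m) (Fin n × Fin m) ℂ) =
      ∑ i, ∑ j, Matrix.kronecker (Matrix.single i j 1) (Matrix.of fun k l => φ i j (x k l)) := by
    ext ⟨a, k⟩ ⟨b, l⟩
    simp only [Matrix.sum_apply, Matrix.of_apply, Matrix.kronecker, Matrix.kroneckerMap_apply,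
      Matrix.single_apply, ite_and, ite_mul, one_mul, zero_mul]
    simp
  rw [h]
  refine (norm_sum_le _ _).trans (Finset.sum_le_sum fun i _ => (norm_sum_le _ _).trans
    (Finset.sum_le_sum fun j _ => ?_))
  refine le_trans (l2_norm_le _ (norm_nonneg _) fun ξ => ?_) (X.norm_functional_le (φ i j) m x)
  have h1 := sq_norm_mulVec_le (Matrix.of fun k l => φ i j (x k l)) fun l => ξ (j, l)
  refine le_trans (le_of_eq ?_) (h1.trans ?_)
  · simp only [Fintype.sum_prod_type, Matrix.mulVec, dotProduct, Matrix.kronecker,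
      Matrix.kroneckerMap_apply, Matrix.single_apply, ite_and, ite_mul, one_mul, zero_mul,
      Matrix.of_apply]
    rw [Finset.sum_eq_single i (fun b _ hb => by simp [Ne.symm hb]) (by simp)]
    refine Finset.sum_congr rfl fun k _ => ?_
    simp
  · gcongr
    rw [Fintype.sum_prod_type]
    exact Finset.single_le_sum (f := fun a => ∑ l, ‖ξ (a, l)‖ ^ 2)
      (fun _ _ => by positivity) (Finset.mem_univ j)

/-- The matrix pairing between an operator space and its dual is contractive. -/
lemma norm_pairing_le (X : OperatorSpaceStructure V) {n m : ℕ}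
    (φ : Matrix (Fin n) (Fin n) (StrongDual ℂ V)) (x : Matrix (Fin m) (Fin m) V) :
    ‖(Matrix.of fun s t => φ s.1 t.1 (x s.2 t.2) :
      Matrix (Fin n × Fin m) (Fin n × Fin m) ℂ)‖ ≤ X.dual.matNorm n φ * X.matNorm m x := by
  have hx := X.matNorm_nonneg m x
  have hφ := X.dual.matNorm_nonneg n φ
  rcases hx.eq_or_lt with h0 | h0
  · have := X.eq_zero m x h0.symm
    subst this
    refine le_trans (le_of_eq ?_) (by positivity : (0 : ℝ) ≤ _)
    rw [norm_eq_zero]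
    ext s t
    simp
  · have h1 : X.matNorm m (((X.matNorm m x)⁻¹ : ℂ) • x) ≤ 1 := by
      rw [X.smul_eq, norm_inv, Complex.norm_real, Real.norm_of_nonneg hx, inv_mul_cancel₀ h0.ne']
    have hb : BddAbove (Set.range
        fun p : {p : Σ m : ℕ, Matrix (Fin m) (Fin m) V // X.matNorm p.1 p.2 ≤ 1} =>
        ‖(Matrix.of fun s t => φ s.1 t.1 (p.1.2 s.2 t.2) :
          Matrix (Fin n × Fin p.1.1) (Fin n × Fin p.1.1) ℂ)‖) := by
      refine ⟨∑ i, ∑ j, ‖φ i j‖ * 1, ?_⟩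
      rintro _ ⟨p, rfl⟩
      refine (X.norm_pairing_le_sum φ p.1.2).trans ?_
      gcongr
      exact p.2
    have h2 := le_ciSup hb ⟨⟨m, ((X.matNorm m x)⁻¹ : ℂ) • x⟩, h1⟩
    rw [← dual_matNorm] at h2
    have h3 : (Matrix.of fun s t => φ s.1 t.1 (x s.2 t.2) :
        Matrix (Fin n × Fin m) (Fin n × Fin m) ℂ) = (X.matNorm m x : ℂ) •
        (Matrix.of fun s t => φ s.1 t.1 ((((X.matNorm m x)⁻¹ : ℂ) • x) s.2 t.2) :
        Matrix (Fin n × Fin m) (Fin n × Fin m) ℂ) := by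
      ext s t
      simp [Complex.ofReal_ne_zero.2 h0.ne']
    rw [h3, norm_smul, Complex.norm_real, Real.norm_of_nonneg hx, mul_comm]
    exact mul_le_mul_of_nonneg_right h2 hx

lemma dual_matNorm_le (X : OperatorSpaceStructure V) {n : ℕ}
    (φ : Matrix (Fin n) (Fin n) (StrongDual ℂ V)) {C : ℝ}
    (h : ∀ (m : ℕ) (x : Matrix (Fin m) (Fin m) V), X.matNorm m x ≤ 1 →
      ‖(Matrix.of fun s t => φ s.1 t.1 (x s.2 t.2) :
        Matrix (Fin n × Fin m) (Fin n × Fin m) ℂ)‖ ≤ C) : X.dual.matNorm n φ ≤ C := by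
  have : Nonempty {p : Σ m : ℕ, Matrix (Fin m) (Fin m) V // X.matNorm p.1 p.2 ≤ 1} :=
    ⟨⟨⟨0, 0⟩, by simpa using (X.smul_eq 0 0 0).trans_le (by simp)⟩⟩
  rw [dual_matNorm]
  exact ciSup_le fun p => h _ _ p.2

end OperatorSpaceStructure

/-! ### Invariant subspaces of an operator amenable algebra. -/

section Splitting

variable {A : Type*} [NonUnitalNormedRing A] [NormedSpace ℂ A] {H : Type*}
  [NormedAddCommGroup H] [InnerProductSpace ℂ H]

/-- A linear map into the operators on a Hilbert space is completely contractive. -/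
def CompletelyContractiveOn (X : OperatorSpaceStructure A) (π : A →ₗ[ℂ] H →L[ℂ] H) : Prop :=
  ∀ (n : ℕ) (a : Matrix (Fin n) (Fin n) A) (x : Fin n → H),
    ∑ i, ‖∑ j, π (a i j) (x j)‖ ^ 2 ≤ X.matNorm n a ^ 2 * ∑ j, ‖x j‖ ^ 2

/-- The operators that vanish on `K` and have their range in `K`. -/
def cornerSubmodule (K : Submodule ℂ H) : Submodule ℂ (H →L[ℂ] H) where
  carrier := {T | (∀ x ∈ K, T x = 0) ∧ ∀ x, T x ∈ K}
  add_mem' hS hT := ⟨fun x hx => by simp [hS.1 x hx, hT.1 x hx],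
    fun x => K.add_mem (hS.2 x) (hT.2 x)⟩
  zero_mem' := by simp
  smul_mem' c T hT := ⟨fun x hx => by simp [hT.1 x hx], fun x => K.smul_mem c (hT.2 x)⟩

variable {K : Submodule ℂ H}

lemma divNat_finProdFinEquiv {m n : ℕ} (p : Fin m × Fin n) : (finProdFinEquiv p).divNat = p.1 :=
  congrArg Prod.fst (finProdFinEquiv.symm_apply_apply p)

lemma modNat_finProdFinEquiv {m n : ℕ} (p : Fin m × Fin n) : (finProdFinEquiv p).modNat = p.2 :=
  congrArg Prod.snd (finProdFinEquiv.symm_apply_apply p)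

/-- `cornerSubmodule K` as a normed space. -/
def Corner (K : Submodule ℂ H) : Type _ := cornerSubmodule K

noncomputable instance : NormedAddCommGroup (Corner K) :=
  inferInstanceAs (NormedAddCommGroup (cornerSubmodule K))

noncomputable instance : NormedSpace ℂ (Corner K) :=
  inferInstanceAs (NormedSpace ℂ (cornerSubmodule K))

/-- The inclusion of `Corner K` into the bounded operators. -/
noncomputable def cornerIncl (K : Submodule ℂ H) : Corner K →ₗᵢ[ℂ] H →L[ℂ] H :=
  (cornerSubmodule K).subtypeₗᵢ

lemma cornerIncl_apply_of_mem (T : Corner K) {x : H} (hx : x ∈ K) : cornerIncl K T x = 0 :=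
  T.2.1 x hx

lemma cornerIncl_apply_mem (T : Corner K) (x : H) : cornerIncl K T x ∈ K :=
  T.2.2 x

/-- A linear map into the operators with values in `cornerSubmodule K`. -/
noncomputable def toCorner {V : Type*} [AddCommGroup V] [Module ℂ V] (f : V →ₗ[ℂ] H →L[ℂ] H)
    (hf : ∀ v, (∀ x ∈ K, f v x = 0) ∧ ∀ x, f v x ∈ K) : V →ₗ[ℂ] Corner K :=
  LinearMap.codRestrict (cornerSubmodule K) f hf

/-- The operator space structure of `Corner K`. -/
noncomputable abbrev cornerStructure (K : Submodule ℂ H) : OperatorSpaceStructure (Corner K) :=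
  concreteStructure (cornerIncl K)

/-- Composition on the left with an operator that leaves `K` invariant. -/
noncomputable def cornerMulLeft (S : H →L[ℂ] H) (hS : ∀ x ∈ K, S x ∈ K) : Corner K →L[ℂ] Corner K :=
  (toCorner ((LinearMap.mulLeft ℂ S) ∘ₗ (cornerIncl K).toLinearMap) fun T =>
    ⟨fun x hx => by simp [cornerIncl_apply_of_mem T hx],
      fun x => hS _ (cornerIncl_apply_mem T x)⟩).mkContinuous ‖S‖ fun T => by
    rw [← (cornerIncl K).norm_map, ← (cornerIncl K).norm_map]
    exact norm_mul_le S (cornerIncl K T)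

/-- Composition on the right with an operator that leaves `K` invariant. -/
noncomputable def cornerMulRight (S : H →L[ℂ] H) (hS : ∀ x ∈ K, S x ∈ K) :
    Corner K →L[ℂ] Corner K :=
  (toCorner ((LinearMap.mulRight ℂ S) ∘ₗ (cornerIncl K).toLinearMap) fun T =>
    ⟨fun x hx => by simp [cornerIncl_apply_of_mem T (hS x hx)],
      fun _ => cornerIncl_apply_mem T _⟩).mkContinuous ‖S‖ fun T => by
    rw [← (cornerIncl K).norm_map, ← (cornerIncl K).norm_map, mul_comm]
    exact norm_mul_le (cornerIncl K T) S

@[simp] lemma cornerIncl_cornerMulLeft (S : H →L[ℂ] H) (hS : ∀ x ∈ K, S x ∈ K) (T : Corner K) :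
    cornerIncl K (cornerMulLeft S hS T) = S * cornerIncl K T := rfl

@[simp] lemma cornerIncl_cornerMulRight (S : H →L[ℂ] H) (hS : ∀ x ∈ K, S x ∈ K) (T : Corner K) :
    cornerIncl K (cornerMulRight S hS T) = cornerIncl K T * S := rfl

/-- The left action on the dual of `Corner K`. -/
noncomputable def cornerLeft (π : A →ₗ[ℂ] H →L[ℂ] H) (hK : ∀ a, ∀ x ∈ K, π a x ∈ K) :
    A →ₗ[ℂ] StrongDual ℂ (Corner K) →ₗ[ℂ] StrongDual ℂ (Corner K) :=
  -- Right multiplication on the corner reverses products, and dualising reverses them again, so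
  -- this is a left action.
  LinearMap.mk₂ ℂ (fun a ω => ω ∘L cornerMulRight (π a) (hK a))
    (fun a b ω => by
      ext T; simp only [ContinuousLinearMap.comp_apply, add_apply, ← map_add]
      congr 1; refine (cornerIncl K).injective ?_; simp [mul_add])
    (fun c a ω => by
      ext T; simp only [ContinuousLinearMap.comp_apply, smul_apply, ← map_smul]
      congr 1; refine (cornerIncl K).injective ?_; simp)
    (fun a ω ω' => rfl) (fun c a ω => rfl)

@[simp] lemma cornerLeft_apply (π : A →ₗ[ℂ] H →L[ℂ] H) (hK : ∀ a, ∀ x ∈ K, π a x ∈ K) (a : A)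
    (ω : StrongDual ℂ (Corner K)) (T : Corner K) :
    cornerLeft π hK a ω T = ω (cornerMulRight (π a) (hK a) T) := rfl

/-- The right action on the dual of `Corner K`. -/
noncomputable def cornerRight (π : A →ₗ[ℂ] H →L[ℂ] H) (hK : ∀ a, ∀ x ∈ K, π a x ∈ K) :
    A →ₗ[ℂ] StrongDual ℂ (Corner K) →ₗ[ℂ] StrongDual ℂ (Corner K) :=
  LinearMap.mk₂ ℂ (fun a ω => ω ∘L cornerMulLeft (π a) (hK a))
    (fun a b ω => by
      ext T; simp only [ContinuousLinearMap.comp_apply, add_apply, ← map_add]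
      congr 1; refine (cornerIncl K).injective ?_; simp [add_mul])
    (fun c a ω => by
      ext T; simp only [ContinuousLinearMap.comp_apply, smul_apply, ← map_smul]
      congr 1; refine (cornerIncl K).injective ?_; simp)
    (fun a ω ω' => rfl) (fun c a ω => rfl)

@[simp] lemma cornerRight_apply (π : A →ₗ[ℂ] H →L[ℂ] H) (hK : ∀ a, ∀ x ∈ K, π a x ∈ K) (a : A)
    (ω : StrongDual ℂ (Corner K)) (T : Corner K) :
    cornerRight π hK a ω T = ω (cornerMulLeft (π a) (hK a) T) := rfl

/-- The dual of `Corner K` as an operator bimodule. -/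
noncomputable def cornerBimodule (X : OperatorSpaceStructure A) (π : A →ₗ[ℂ] H →L[ℂ] H)
    (hπ : ∀ a b, π (a * b) = π a * π b) (hc : CompletelyContractiveOn X π)
    (hK : ∀ a, ∀ x ∈ K, π a x ∈ K) :
    OperatorBimodule X (cornerStructure K).dual where
  left := cornerLeft π hK
  right := cornerRight π hK
  left_mul a b ω := by
    ext T; simp only [cornerLeft_apply]
    congr 1; refine (cornerIncl K).injective ?_; simp [hπ, mul_assoc]
  right_mul a b ω := by
    ext T; simp only [cornerRight_apply]
    congr 1; refine (cornerIncl K).injective ?_; simp [hπ, mul_assoc]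
  left_right a b ω := by
    ext T; simp only [cornerLeft_apply, cornerRight_apply]
    congr 1
  left_cb := by
    refine ⟨1, fun m n a ω => ?_⟩
    rw [one_mul, mul_comm (X.matNorm m a)]
    refine OperatorSpaceStructure.dual_matNorm_le _ _ fun p T hT => ?_
    rw [concreteStructure_matNorm] at hT
    -- The action is moved from `ω` to `T`: the pairing of `a · ω` with `T` is the pairing of `ω`
    -- with the matrix `[T π(a)]`, whose norm is at most `‖T‖ ‖a‖`.
    let y : Matrix (Fin p × Fin m) (Fin p × Fin m) (Corner K) :=
      Matrix.of fun s t => cornerMulRight (π (a s.2 t.2)) (hK _) (T s.1 t.1)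
    have hy : (cornerStructure K).matNorm (p * m)
        (Matrix.reindex finProdFinEquiv finProdFinEquiv y) ≤ X.matNorm m a := by
      refine norm_matOp_le_of_equiv (y.map (cornerIncl K))
        (X.matNorm_nonneg m a) finProdFinEquiv fun x => ?_
      refine (sq_norm_sum_comp_le (T.map (cornerIncl K)) (a.map π) (C := 1)
        (fun x => (sq_norm_sum_apply_le _ x).trans ?_) (hc m a) x).trans (by rw [one_mul])
      gcongr
    -- Only a permutation of indices: `T` stands before `a` in `y`, whereas the bilinear
    -- amplification indexes by `a`, then `ω`, then `T`.
    refine le_trans (le_trans (le_of_eq ?_) (l2_norm_reindex_le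
      (((Equiv.refl (Fin n)).prodCongr finProdFinEquiv.symm).trans
        (((Equiv.refl (Fin n)).prodCongr (Equiv.prodComm _ _)).trans
        ((Equiv.prodAssoc _ _ _).symm.trans
        (((Equiv.prodComm _ _).trans finProdFinEquiv).prodCongr (Equiv.refl (Fin p))))))
      (((Equiv.refl (Fin n)).prodCongr finProdFinEquiv.symm).trans
        (((Equiv.refl (Fin n)).prodCongr (Equiv.prodComm _ _)).trans
        ((Equiv.prodAssoc _ _ _).symm.trans
        (((Equiv.prodComm _ _).trans finProdFinEquiv).prodCongr (Equiv.refl (Fin p)))))) _))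
      ((OperatorSpaceStructure.norm_pairing_le _ ω
        (Matrix.reindex finProdFinEquiv finProdFinEquiv y)).trans
        (mul_le_mul_of_nonneg_left hy (OperatorSpaceStructure.matNorm_nonneg _ _ _)))
    congr 1
    ext s t
    simp [y, divNat_finProdFinEquiv, modNat_finProdFinEquiv]
  right_cb := by
    refine ⟨1, fun m n a ω => ?_⟩
    rw [one_mul, mul_comm (X.matNorm m a)]
    refine OperatorSpaceStructure.dual_matNorm_le _ _ fun p T hT => ?_
    rw [concreteStructure_matNorm] at hT
    let y : Matrix (Fin m × Fin p) (Fin m × Fin p) (Corner K) :=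
      Matrix.of fun s t => cornerMulLeft (π (a s.1 t.1)) (hK _) (T s.2 t.2)
    have hy : (cornerStructure K).matNorm (m * p)
        (Matrix.reindex finProdFinEquiv finProdFinEquiv y) ≤ X.matNorm m a := by
      refine norm_matOp_le_of_equiv (y.map (cornerIncl K))
        (X.matNorm_nonneg m a) finProdFinEquiv fun x => ?_
      refine (sq_norm_sum_comp_le (a.map π) (T.map (cornerIncl K)) (D := 1) (hc m a)
        (fun x => (sq_norm_sum_apply_le _ x).trans ?_) x).trans (by rw [mul_one])
      gcongr
    refine le_trans (le_trans (le_of_eq ?_) (l2_norm_reindex_le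
      (((Equiv.refl (Fin n)).prodCongr finProdFinEquiv.symm).trans
        ((Equiv.prodAssoc _ _ _).symm.trans
        (((Equiv.prodComm _ _).trans finProdFinEquiv).prodCongr (Equiv.refl (Fin p)))))
      (((Equiv.refl (Fin n)).prodCongr finProdFinEquiv.symm).trans
        ((Equiv.prodAssoc _ _ _).symm.trans
        (((Equiv.prodComm _ _).trans finProdFinEquiv).prodCongr (Equiv.refl (Fin p))))) _))
      ((OperatorSpaceStructure.norm_pairing_le _ ω
        (Matrix.reindex finProdFinEquiv finProdFinEquiv y)).trans
        (mul_le_mul_of_nonneg_left hy (OperatorSpaceStructure.matNorm_nonneg _ _ _)))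
    congr 1
    ext s t
    simp [y, divNat_finProdFinEquiv, modNat_finProdFinEquiv]

/-- The commutators `π a P - P π a` with the orthogonal projection `P` onto an invariant
subspace. -/
noncomputable def cornerCommutator [K.HasOrthogonalProjection] (π : A →ₗ[ℂ] H →L[ℂ] H)
    (hK : ∀ a, ∀ x ∈ K, π a x ∈ K) : A →ₗ[ℂ] Corner K :=
  toCorner
    { toFun := fun a => π a * K.starProjection - K.starProjection * π a
      map_add' := fun a b => by simp [add_mul, mul_add]; abel
      map_smul' := fun c a => by simp [smul_sub] }
    -- On `K` both products equal `π a`, so they cancel; both have range in `K` by invariance.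
    fun a => ⟨fun x hx => by
      simp [Submodule.starProjection_eq_self_iff.2 hx,
        Submodule.starProjection_eq_self_iff.2 (hK a x hx)],
      fun x => K.sub_mem (hK _ _ (Submodule.starProjection_apply_mem _ _))
        (Submodule.starProjection_apply_mem _ _)⟩

@[simp] lemma cornerIncl_cornerCommutator [K.HasOrthogonalProjection] (π : A →ₗ[ℂ] H →L[ℂ] H)
    (hK : ∀ a, ∀ x ∈ K, π a x ∈ K) (a : A) :
    cornerIncl K (cornerCommutator π hK a) = π a * K.starProjection - K.starProjection * π a := rfl

/-- The amplification of `P` is a contraction, and `‖u - v‖² ≤ 2‖u‖² + 2‖v‖²` yields the factor `4 =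
2²`. -/
lemma cornerCommutator_bound [K.HasOrthogonalProjection] {X : OperatorSpaceStructure A}
    {π : A →ₗ[ℂ] H →L[ℂ] H} (hc : CompletelyContractiveOn X π)
    (hK : ∀ a, ∀ x ∈ K, π a x ∈ K) (n : ℕ) (a : Matrix (Fin n) (Fin n) A) :
    (cornerStructure K).matNorm n (a.map (cornerCommutator π hK)) ≤
      2 * X.matNorm n a := by
  have h0 := X.matNorm_nonneg n a
  refine norm_matOp_le _ (by positivity) fun x => ?_
  have hP : ∀ x, ‖K.starProjection x‖ ^ 2 ≤ ‖x‖ ^ 2 := fun x =>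
    pow_le_pow_left₀ (norm_nonneg _) (K.norm_starProjection_apply_le x) 2
  calc _ = ∑ i, ‖(∑ j, π (a i j) (K.starProjection (x j))) -
        K.starProjection (∑ j, π (a i j) (x j))‖ ^ 2 := by simp
    _ ≤ ∑ i, (2 * ‖∑ j, π (a i j) (K.starProjection (x j))‖ ^ 2 +
        2 * ‖∑ j, π (a i j) (x j)‖ ^ 2) := by
      refine Finset.sum_le_sum fun i _ => ?_
      have h1 := norm_sub_le (∑ j, π (a i j) (K.starProjection (x j)))
        (K.starProjection (∑ j, π (a i j) (x j)))
      have h2 := hP (∑ j, π (a i j) (x j))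
      have h3 := pow_le_pow_left₀ (norm_nonneg _) h1 2
      nlinarith [sq_nonneg (‖∑ j, π (a i j) (K.starProjection (x j))‖ -
        ‖K.starProjection (∑ j, π (a i j) (x j))‖)]
    _ = 2 * ∑ i, ‖∑ j, π (a i j) (K.starProjection (x j))‖ ^ 2 +
        2 * ∑ i, ‖∑ j, π (a i j) (x j)‖ ^ 2 := by
      rw [Finset.sum_add_distrib, Finset.mul_sum, Finset.mul_sum]
    _ ≤ 2 * (X.matNorm n a ^ 2 * ∑ j, ‖x j‖ ^ 2) + 2 * (X.matNorm n a ^ 2 * ∑ j, ‖x j‖ ^ 2) := by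
      gcongr
      · refine (hc n a _).trans ?_
        gcongr ?_ * ?_
        exact Finset.sum_le_sum fun j _ => hP _
      · exact hc n a x
    _ = _ := by ring

/-- The functional `T ↦ ⟪y, T x⟫`. -/
noncomputable def vectorFunctional (K : Submodule ℂ H) (y x : H) :
    StrongDual ℂ (Corner K) :=
  (innerSL ℂ y) ∘L (ContinuousLinearMap.apply ℂ H x) ∘L (cornerIncl K).toContinuousLinearMap

@[simp] lemma vectorFunctional_apply (y x : H) (T : Corner K) :
    vectorFunctional K y x T = ⟪y, (cornerIncl K T) x⟫_ℂ := rfl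

lemma norm_vectorFunctional_le (y x : H) : ‖vectorFunctional K y x‖ ≤ ‖y‖ * ‖x‖ := by
  refine ContinuousLinearMap.opNorm_le_bound _ (by positivity) fun T => ?_
  rw [vectorFunctional_apply, mul_assoc, mul_comm ‖x‖]
  exact (norm_inner_le_norm _ _).trans (mul_le_mul_of_nonneg_left
    ((cornerIncl K T).le_opNorm x) (norm_nonneg _))

/-- A functional on the dual of a space of operators is given, on the vector functionals, by an
operator. -/
lemma exists_operator_of_bidual [CompleteSpace H]
    (Φ : StrongDual ℂ (StrongDual ℂ (Corner K))) :
    ∃ T : H →L[ℂ] H, ∀ y x, ⟪y, T x⟫_ℂ = Φ (vectorFunctional K y x) := by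
  -- `Φ` on vector functionals is a bounded sesquilinear form, which Riesz representation turns into
  -- an operator.
  let F : H →L⋆[ℂ] H →L[ℂ] ℂ := LinearMap.mkContinuous₂
    (LinearMap.mk₂'ₛₗ (starRingEnd ℂ) (RingHom.id ℂ) (fun y x => Φ (vectorFunctional K y x))
      (fun y y' x => by
        rw [← map_add]; congr 1; ext T; simp)
      (fun c y x => by
        rw [smul_eq_mul, ← smul_eq_mul, ← map_smul]; congr 1; ext T; simp [mul_comm])
      (fun y x x' => by
        rw [← map_add]; congr 1; ext T; simp)
      (fun c y x => by
        rw [RingHom.id_apply, ← map_smul]; congr 1; ext T; simp))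
    ‖Φ‖ fun y x => (Φ.le_opNorm _).trans (by
      rw [mul_assoc]
      exact mul_le_mul_of_nonneg_left (norm_vectorFunctional_le y x) (norm_nonneg _))
  refine ⟨ContinuousLinearMap.adjoint (InnerProductSpace.continuousLinearMapOfBilin F),
    fun y x => ?_⟩
  rw [ContinuousLinearMap.adjoint_inner_right, InnerProductSpace.continuousLinearMapOfBilin_apply]
  rfl

/-- For an operator amenable algebra that acts completely contractively on a Hilbert space, every
closed invariant subspace is the range of an idempotent that commutes with the action. -/
theorem OperatorAmenable.exists_idempotent {A : Type u} [NonUnitalNormedRing A] [NormedSpace ℂ A]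
    [IsScalarTower ℂ A A] [SMulCommClass ℂ A A] {X : OperatorSpaceStructure A}
    (hX : OperatorAmenable X) {H : Type u} [NormedAddCommGroup H] [InnerProductSpace ℂ H]
    [CompleteSpace H] (π : A →ₗ[ℂ] H →L[ℂ] H) (hπ : ∀ a b, π (a * b) = π a * π b)
    (hc : CompletelyContractiveOn X π) (K : Submodule ℂ H) [K.HasOrthogonalProjection]
    (hK : ∀ a, ∀ x ∈ K, π a x ∈ K) :
    ∃ Q : H →L[ℂ] H, (∀ x, Q x ∈ K) ∧ (∀ x ∈ K, Q x = x) ∧ ∀ a, Commute (π a) Q := by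
  let M := cornerBimodule X π hπ hc hK
  -- The derivation is implemented by `P`, which does not kill `K`. Amenability is used to replace
  -- `P` by an operator `T` that does, so that subtracting `T` keeps the identity on `K`.
  let D : A →ₗ[ℂ] StrongDual ℂ (StrongDual ℂ (Corner K)) :=
    (NormedSpace.inclusionInDoubleDual ℂ (Corner K)).toLinearMap ∘ₗ cornerCommutator π hK
  have hD : ∀ a ω, D a ω = ω (cornerCommutator π hK a) := fun a ω => rfl
  have hcb : CompletelyBounded X (cornerStructure K).dual.dual D := by
    refine ⟨2, fun n a => OperatorSpaceStructure.dual_matNorm_le _ _ fun m ω hω => ?_⟩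
    refine le_trans (le_trans (le_of_eq ?_) (l2_norm_reindex_le (Equiv.prodComm _ _)
      (Equiv.prodComm _ _) _)) (((cornerStructure K).norm_pairing_le ω
        (a.map (cornerCommutator π hK))).trans
        ((mul_le_of_le_one_left (OperatorSpaceStructure.matNorm_nonneg _ _ _) hω).trans
          (cornerCommutator_bound hc hK n a)))
    congr 1
  have hder : M.IsDerivation D := by
    intro a b ω
    change ω _ = ω (cornerMulLeft (π a) (hK a) _) + ω (cornerMulRight (π b) (hK b) _)
    rw [← map_add]
    congr 1
    refine (cornerIncl K).injective ?_
    simp only [cornerIncl_cornerCommutator, map_add, cornerIncl_cornerMulLeft,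
      cornerIncl_cornerMulRight, hπ]
    noncomm_ring
  obtain ⟨Φ, hΦ⟩ := hX _ _ M D hcb hder
  obtain ⟨T, hT⟩ := exists_operator_of_bidual Φ
  -- `T` inherits both corner properties because the vector functional of `y` and `x` is zero on the
  -- corner when `x ∈ K` or `y ⊥ K`.
  have hT0 : ∀ x ∈ K, T x = 0 := fun x hx => by
    refine ext_inner_left ℂ fun y => ?_
    rw [hT, inner_zero_right]
    convert map_zero Φ
    ext S
    simp [cornerIncl_apply_of_mem S hx]
  have hTK : ∀ x, T x ∈ K := fun x => by
    rw [← K.orthogonal_orthogonal, Submodule.mem_orthogonal]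
    intro y hy
    rw [hT]
    convert map_zero Φ
    ext S
    simpa using (Submodule.mem_orthogonal' K y).1 hy _ (cornerIncl_apply_mem S x)
  refine ⟨K.starProjection - T, fun x => K.sub_mem (Submodule.starProjection_apply_mem _ _) (hTK x),
    fun x hx => ?_, fun a => ?_⟩
  · simp [hT0 x hx, Submodule.starProjection_eq_self_iff.2 hx]
  · have h : π a * K.starProjection - K.starProjection * π a = π a * T - T * π a := by
      ext x
      refine ext_inner_left ℂ fun y => ?_
      have h1 := hΦ a (vectorFunctional K y x)
      have h2 : M.right a (vectorFunctional K y x) =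
          vectorFunctional K (ContinuousLinearMap.adjoint (π a) y) x := by
        ext S
        simp [M, cornerBimodule, ContinuousLinearMap.adjoint_inner_left]
      have h3 : M.left a (vectorFunctional K y x) = vectorFunctional K y (π a x) := rfl
      rw [hD, h2, h3, ← hT, ← hT, ContinuousLinearMap.adjoint_inner_left, ← inner_sub_right] at h1
      exact h1
    rw [Commute, SemiconjBy, mul_sub, sub_mul, ← sub_eq_zero, ← sub_eq_zero.2 h]
    abel

/-- An operator amenable algebra of normal operators on a Hilbert space has only reducing
invariant subspaces. -/
theorem OperatorAmenable.adjoint_mem {A : Type u} [NonUnitalNormedRing A] [NormedSpace ℂ A]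
    [IsScalarTower ℂ A A] [SMulCommClass ℂ A A] {X : OperatorSpaceStructure A}
    (hX : OperatorAmenable X) {H : Type u} [NormedAddCommGroup H] [InnerProductSpace ℂ H]
    [CompleteSpace H] (π : A →ₗ[ℂ] H →L[ℂ] H) (hπ : ∀ a b, π (a * b) = π a * π b)
    (hc : CompletelyContractiveOn X π) (hn : ∀ a, IsStarNormal (π a)) (K : Submodule ℂ H)
    [K.HasOrthogonalProjection] (hK : ∀ a, ∀ x ∈ K, π a x ∈ K) (a : A) {x : H} (hx : x ∈ K) :
    star (π a) x ∈ K := by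
  obtain ⟨Q, hQ, hQx, hcomm⟩ := hX.exists_idempotent π hπ hc K hK
  have := hn a
  -- Fuglede's theorem: what commutes with a normal operator commutes with its adjoint.
  have h := congrArg (fun S : H →L[ℂ] H => S x) (this.commute_star_left (hcomm a)).eq
  simp only [mul_apply_eq_comp, hQx x hx] at h
  rw [h]
  exact hQ _

end Splitting

/-! ### Dominating a functional on `C(Ω, ℂ)` by a positive one. -/

section ContinuousFunctions

open scoped ComplexOrder

variable {Ω : Type*} [TopologicalSpace Ω]

/-- A functional whose real part is nonnegative on the functions with nonnegative real part is
positive. -/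
lemma functional_nonneg_of_re (f : StrongDual ℂ C(Ω, ℂ))
    (hf : ∀ g : C(Ω, ℂ), (∀ ω, 0 ≤ (g ω).re) → 0 ≤ (f g).re) (g : C(Ω, ℂ)) (hg : 0 ≤ g) :
    0 ≤ f g := by
  have h : ∀ ω, 0 ≤ (g ω).re ∧ 0 = (g ω).im := fun ω => Complex.le_def.1 (hg ω)
  -- Both `i g` and `-i g` have zero real part, which forces `f g` to be real.
  have h1 := hf (Complex.I • g) fun ω => by simp [← (h ω).2]
  have h2 := hf (-(Complex.I • g)) fun ω => by simp [← (h ω).2]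
  simp only [map_neg, map_smul, smul_eq_mul, Complex.neg_re, Complex.I_mul_re] at h1 h2
  exact Complex.le_def.2 ⟨hf g fun ω => (h ω).1, by simp; linarith⟩

variable [CompactSpace Ω]

/-- A functional on `C(Ω, ℂ)` satisfies the little Grothendieck inequality with constant one. -/
lemma sum_sq_norm_functional_le {ι : Type*} [Fintype ι] (l : StrongDual ℂ C(Ω, ℂ))
    (b : ι → C(Ω, ℂ)) {M : ℝ} (hM : 0 ≤ M) (h : ∀ ω, ∑ i, ‖b i ω‖ ^ 2 ≤ M) :
    ∑ i, ‖l (b i)‖ ^ 2 ≤ ‖l‖ ^ 2 * M := by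
  set t := ∑ i, ‖l (b i)‖ ^ 2 with ht
  have ht0 : 0 ≤ t := by positivity
  -- This combination is chosen so that `l` maps it to `t`. Its norm is bounded by Cauchy-Schwarz at
  -- each point, giving `t² ≤ ‖l‖² t M`.
  have h1 : ‖∑ i, star (l (b i)) • b i‖ ≤ √(t * M) := by
    refine (ContinuousMap.norm_le _ (Real.sqrt_nonneg _)).2 fun ω => Real.le_sqrt_of_sq_le ?_
    have h2 : ‖(∑ i, star (l (b i)) • b i) ω‖ ≤ ∑ i, ‖l (b i)‖ * ‖b i ω‖ := by
      simpa using norm_sum_le Finset.univ fun i => star (l (b i)) * b i ω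
    refine (pow_le_pow_left₀ (norm_nonneg _) h2 2).trans ?_
    refine (Finset.sum_mul_sq_le_sq_mul_sq _ _ _).trans ?_
    gcongr
    exact h ω
  have h3 : l (∑ i, star (l (b i)) • b i) = (t : ℂ) := by
    simp [ht, Complex.conj_mul']
  have h4 := l.le_opNorm (∑ i, star (l (b i)) • b i)
  rw [h3, Complex.norm_real, Real.norm_of_nonneg ht0] at h4
  have h5 := pow_le_pow_left₀ ht0 (h4.trans (mul_le_mul_of_nonneg_left h1 (norm_nonneg _))) 2
  rw [mul_pow, Real.sq_sqrt (by positivity)] at h5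
  rcases ht0.eq_or_lt with h0 | h0
  · rw [← h0]; positivity
  · refine le_of_mul_le_mul_left ?_ h0
    linarith

/-- Every functional on `C(Ω, ℂ)` is dominated, in the Hilbert space sense, by a positive one. -/
theorem exists_positive_dominating [Nonempty Ω] (l : StrongDual ℂ C(Ω, ℂ)) :
    ∃ φ : C(Ω, ℂ) →ₚ[ℂ] ℂ, ∀ b, ‖l b‖ ^ 2 ≤ (φ (star b * b)).re := by
  -- A positive `f` with `f (gen b) ≥ 0` for all `b` is the desired φ up to scaling. It comes from
  -- separating the sums of such functions from the open cone of functions with negative real part.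
  let gen : C(Ω, ℂ) → C(Ω, ℂ) := fun b =>
    ((‖l‖ ^ 2 : ℝ) : ℂ) • (star b * b) - ((‖l b‖ ^ 2 : ℝ) : ℂ) • 1
  have gen_smul : ∀ (c : ℝ), 0 ≤ c → ∀ b, gen ((√c : ℂ) • b) = c • gen b := by
    intro c hc b
    have hs : (√c : ℂ) * √c = c := by rw [← Complex.ofReal_mul, Real.mul_self_sqrt hc]
    ext ω
    simp only [gen, map_smul, norm_smul, Complex.norm_real, mul_pow, Real.norm_eq_abs, sq_abs,
      Real.sq_sqrt hc]
    simp only [ContinuousMap.sub_apply, ContinuousMap.smul_apply, ContinuousMap.mul_apply,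
      ContinuousMap.star_apply, ContinuousMap.one_apply, smul_eq_mul, Complex.star_def, map_mul,
      Complex.conj_ofReal, Complex.real_smul, Complex.ofReal_mul]
    linear_combination ((‖l‖ ^ 2 : ℝ) : ℂ) * ((starRingEnd ℂ) (b ω) * b ω) * hs
  let S : Set C(Ω, ℂ) := {g | ∃ (n : ℕ) (b : Fin n → C(Ω, ℂ)), g = ∑ i, gen (b i)}
  let U : Set C(Ω, ℂ) := {g | Set.MapsTo g Set.univ {z : ℂ | z.re < 0}}
  have hUo : IsOpen U := ContinuousMap.isOpen_setOfPred_mapsTo isCompact_univ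
    (isOpen_lt Complex.continuous_re continuous_const)
  have hUc : Convex ℝ U := fun x hx y hy a b ha hb hab ω _ =>
    (convex_halfSpace_re_lt 0) (hx (Set.mem_univ ω)) (hy (Set.mem_univ ω)) ha hb hab
  have hSsmul : ∀ c : ℝ, 0 ≤ c → ∀ x ∈ S, c • x ∈ S := by
    rintro c hc _ ⟨n, b, rfl⟩
    exact ⟨n, fun i => (√c : ℂ) • b i, by simp only [gen_smul c hc, Finset.smul_sum]⟩
  have hSadd : ∀ x ∈ S, ∀ y ∈ S, x + y ∈ S := by
    rintro _ ⟨n, b, rfl⟩ _ ⟨m, c, rfl⟩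
    exact ⟨n + m, Fin.append b c, by simp [Fin.sum_univ_add]⟩
  have hSc : Convex ℝ S := fun x hx y hy a b ha hb _ =>
    hSadd _ (hSsmul a ha x hx) _ (hSsmul b hb y hy)
  have hgen : ∀ b, gen b ∈ S := fun b => ⟨1, fun _ => b, by simp⟩
  have gen_re : ∀ b ω, (gen b ω).re = ‖l‖ ^ 2 * ‖b ω‖ ^ 2 - ‖l b‖ ^ 2 := fun b ω => by
    simp only [gen, ContinuousMap.sub_apply, ContinuousMap.smul_apply, ContinuousMap.mul_apply,
      ContinuousMap.star_apply, ContinuousMap.one_apply, smul_eq_mul, Complex.star_def,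
      Complex.conj_mul', ← Complex.ofReal_pow, ← Complex.ofReal_mul, Complex.sub_re,
      Complex.ofReal_re, mul_one]
  have hdisj : Disjoint U S := by
    rw [Set.disjoint_left]
    rintro _ hg ⟨n, b, rfl⟩
    have h1 : ∀ ω, ‖l‖ ^ 2 * ∑ i, ‖b i ω‖ ^ 2 < ∑ i, ‖l (b i)‖ ^ 2 := fun ω => by
      have h2 : ((∑ i, gen (b i)) ω).re < 0 := hg (Set.mem_univ ω)
      simp only [ContinuousMap.sum_apply, Complex.re_sum, gen_re, Finset.sum_sub_distrib] at h2
      rw [Finset.mul_sum]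
      linarith
    -- At a maximum of `∑ ‖b i‖²` the preceding inequality prevents the sum of generators from
    -- having negative real part.
    obtain ⟨ω, -, hω⟩ := isCompact_univ.exists_isMaxOn Set.univ_nonempty
        (f := fun ω => ∑ i, ‖b i ω‖ ^ 2) (by fun_prop)
    have h2 := sum_sq_norm_functional_le l b (M := ∑ i, ‖b i ω‖ ^ 2) (by positivity)
        fun ω' => hω (Set.mem_univ ω')
    exact (h1 ω).not_ge h2
  obtain ⟨f, s, hfU, hfS⟩ := RCLike.geometric_hahn_banach_open (𝕜 := ℂ) hUc hUo hSc hdisj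
  change ∀ a ∈ U, (f a).re < s at hfU
  change ∀ b ∈ S, s ≤ (f b).re at hfS
  have hs : s ≤ 0 := by simpa using hfS 0 ⟨0, 0, by simp⟩
  have h1 : 0 < (f 1).re := by
    have := hfU (-1) fun ω _ => by simp
    simp only [map_neg, Complex.neg_re] at this
    linarith
  have hpos : ∀ g : C(Ω, ℂ), (∀ ω, 0 ≤ (g ω).re) → 0 ≤ (f g).re := by
    intro g hg
    refine le_of_forall_pos_lt_add fun ε hε => ?_
    -- The constant makes the real part strictly positive and costs exactly `ε` under `f`.
    have := hfU (-(g + ((ε / (f 1).re : ℝ) : ℂ) • 1)) fun ω _ => by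
      have := hg ω
      have h2 : 0 < ε / (f 1).re := by positivity
      simp
      linarith
    simp only [map_neg, map_add, map_smul, smul_eq_mul, Complex.neg_re, Complex.add_re,
      Complex.re_ofReal_mul, div_mul_cancel₀ _ h1.ne'] at this
    linarith
  have hS0 : ∀ b, 0 ≤ (f (gen b)).re := by
    intro b
    by_contra! hneg
    -- This multiple of `gen b` would have value `s - 1`, below the separating level `s`.
    have h2 := hfS _ (hSsmul ((1 - s) / (-(f (gen b)).re))
      (div_nonneg (by linarith) (by linarith)) _ (hgen b))
    rw [← Complex.coe_smul, map_smul, smul_eq_mul, Complex.re_ofReal_mul, div_neg, neg_mul,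
      div_mul_cancel₀ _ hneg.ne] at h2
    linarith
  refine ⟨PositiveLinearMap.mk₀ ((((‖l‖ ^ 2 / (f 1).re : ℝ) : ℂ) • f : StrongDual ℂ C(Ω, ℂ)) :
    C(Ω, ℂ) →ₗ[ℂ] ℂ) fun g hg => ?_, fun b => ?_⟩
  · have h2 := functional_nonneg_of_re f hpos g hg
    have h3 : (0 : ℂ) ≤ ((‖l‖ ^ 2 / (f 1).re : ℝ) : ℂ) := by
      exact_mod_cast (by positivity : 0 ≤ ‖l‖ ^ 2 / (f 1).re)
    exact mul_nonneg h3 h2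
  · have h2 := hS0 b
    simp only [gen, map_sub, map_smul, smul_eq_mul, Complex.sub_re, Complex.re_ofReal_mul] at h2
    change _ ≤ (((‖l‖ ^ 2 / (f 1).re : ℝ) : ℂ) * f (star b * b)).re
    rw [Complex.re_ofReal_mul, div_mul_eq_mul_div, le_div_iff₀ h1]
    linarith

/-! ### The GNS representation restricted to an algebra of functions. -/

section UniformAlgebras

variable {Ω : Type*} [TopologicalSpace Ω] [CompactSpace Ω] (φ : C(Ω, ℂ) →ₚ[ℂ] ℂ)

lemma norm_sq_toPreGNS (b : C(Ω, ℂ)) :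
    ‖(φ.toPreGNS b : φ.GNS)‖ ^ 2 = (φ (star b * b)).re := by
  have h := φ.preGNS_norm_sq (φ.toPreGNS b)
  rw [φ.ofPreGNS_toPreGNS] at h
  rw [UniformSpace.Completion.norm_coe, ← h, ← Complex.ofReal_pow, Complex.ofReal_re]

lemma gns_apply_toPreGNS (c b : C(Ω, ℂ)) :
    φ.gnsNonUnitalStarAlgHom c (φ.toPreGNS b : φ.GNS) = (φ.toPreGNS (c * b) : φ.GNS) := by
  rw [φ.gnsNonUnitalStarAlgHom_apply_coe]
  rfl

variable {A : Type*} [NonUnitalNormedRing A] [NormedSpace ℂ A]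

/-- The representation of an algebra of functions on the GNS space of a positive functional. -/
noncomputable def gnsRestrict (ρ : A →ₗ[ℂ] C(Ω, ℂ)) : A →ₗ[ℂ] φ.GNS →L[ℂ] φ.GNS where
  toFun a := φ.gnsNonUnitalStarAlgHom (ρ a)
  map_add' a b := by simp
  map_smul' c a := by simp

lemma gnsRestrict_apply (ρ : A →ₗ[ℂ] C(Ω, ℂ)) (a : A) :
    gnsRestrict φ ρ a = φ.gnsNonUnitalStarAlgHom (ρ a) := rfl

/-- The order is pointwise, and evaluation at a point is a contractive functional, hence completely
contractive by `norm_functional_le`. -/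
lemma sum_star_mul_self_le (ρ : A →ₗ[ℂ] C(Ω, ℂ)) (hρ : ∀ a, ‖ρ a‖ ≤ ‖a‖)
    (X : OperatorSpaceStructure A) {n : ℕ} (a : Matrix (Fin n) (Fin n) A)
    (b : Fin n → C(Ω, ℂ)) :
    ∑ i, star (∑ j, ρ (a i j) * b j) * (∑ j, ρ (a i j) * b j) ≤
      ((X.matNorm n a ^ 2 : ℝ) : ℂ) • ∑ j, star (b j) * b j := by
  intro ω
  let χ : StrongDual ℂ A := LinearMap.mkContinuous
    ((ContinuousMap.evalCLM ℂ ω : C(Ω, ℂ) →L[ℂ] ℂ).toLinearMap ∘ₗ ρ) 1 fun a => by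
      rw [one_mul]
      exact ((ρ a).norm_coe_le_norm ω).trans (hρ a)
  have hχ : ‖χ‖ ≤ 1 := LinearMap.mkContinuous_norm_le _ zero_le_one _
  have h0 := X.matNorm_nonneg n a
  have h1 := (X.norm_functional_le χ n a).trans (mul_le_of_le_one_left h0 hχ)
  have h2 := (sq_norm_mulVec_le (Matrix.of fun k l => χ (a k l)) fun j => b j ω).trans
    (mul_le_mul_of_nonneg_right (pow_le_pow_left₀ (norm_nonneg _) h1 2) (by positivity))
  change (∑ i, star (∑ j, ρ (a i j) * b j) * (∑ j, ρ (a i j) * b j)) ω ≤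
      (((X.matNorm n a ^ 2 : ℝ) : ℂ) • ∑ j, star (b j) * b j) ω
  simp only [ContinuousMap.sum_apply, ContinuousMap.smul_apply, ContinuousMap.mul_apply,
    ContinuousMap.star_apply, smul_eq_mul, Complex.star_def, Complex.conj_mul',
    ← Complex.ofReal_pow, ← Complex.ofReal_mul, ← Complex.ofReal_sum]
  exact Complex.real_le_real.2 h2

/-- Applying the positive `φ` to `sum_star_mul_self_le` gives the estimate for vectors coming from
functions; density does the rest. -/
lemma completelyContractiveOn_gnsRestrict (ρ : A →ₗ[ℂ] C(Ω, ℂ)) (hρ : ∀ a, ‖ρ a‖ ≤ ‖a‖)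
    (X : OperatorSpaceStructure A) : CompletelyContractiveOn X (gnsRestrict φ ρ) := by
  intro n a x
  have hd : DenseRange (Pi.map fun (_ : Fin n) (y : φ.PreGNS) => (y : φ.GNS)) :=
    DenseRange.piMap fun _ => UniformSpace.Completion.denseRange_coe
  refine hd.induction_on x (isClosed_le (by fun_prop) (by fun_prop)) fun y => ?_
  let b : Fin n → C(Ω, ℂ) := fun j => φ.ofPreGNS (y j)
  have hy : ∀ j, (Pi.map fun (_ : Fin n) (y : φ.PreGNS) => (y : φ.GNS)) y j =
      (φ.toPreGNS (b j) : φ.GNS) := fun j => rfl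
  have hsum : ∀ i, ∑ j, (φ.toPreGNS (ρ (a i j) * b j) : φ.GNS) =
      (φ.toPreGNS (∑ j, ρ (a i j) * b j) : φ.GNS) := fun i => by
    rw [map_sum]
    exact (map_sum (UniformSpace.Completion.toCompl (α := φ.PreGNS)) _ _).symm
  have h := Complex.le_def.1 (OrderHomClass.mono φ (sum_star_mul_self_le ρ hρ X a b))
  rw [map_smul, smul_eq_mul, Complex.re_ofReal_mul, map_sum, map_sum, Complex.re_sum,
    Complex.re_sum] at h
  simp only [hy, gnsRestrict_apply, gns_apply_toPreGNS, hsum, norm_sq_toPreGNS]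
  exact h.1

end UniformAlgebras

/-! ### Closedness under the involution. -/

/-- If an algebra of continuous functions is operator amenable, then the conjugates of its members
can be approximated by its members up to constants. -/
theorem OperatorAmenable.star_mem_topologicalClosure {Ω : Type u} [TopologicalSpace Ω]
    [CompactSpace Ω] [Nonempty Ω] {A : Type u} [NonUnitalNormedRing A] [NormedSpace ℂ A]
    [IsScalarTower ℂ A A] [SMulCommClass ℂ A A] {X : OperatorSpaceStructure A}
    (hX : OperatorAmenable X) (ρ : A →ₗ[ℂ] C(Ω, ℂ)) (hmul : ∀ a b, ρ (a * b) = ρ a * ρ b)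
    (hρ : ∀ a, ‖ρ a‖ ≤ ‖a‖) (a : A) :
    star (ρ a) ∈ (LinearMap.range ρ ⊔ Submodule.span ℂ {1}).topologicalClosure := by
  set W := LinearMap.range ρ ⊔ Submodule.span ℂ {(1 : C(Ω, ℂ))}
  have hρW : ∀ a, ρ a ∈ W := fun a => Submodule.mem_sup_left ⟨a, rfl⟩
  have h1W : 1 ∈ W := Submodule.mem_sup_right (Submodule.mem_span_singleton_self _)
  have hρmul : ∀ a, ∀ w ∈ W, ρ a * w ∈ W := by
    intro a w hw
    obtain ⟨_, ⟨b, rfl⟩, _, hc, rfl⟩ := Submodule.mem_sup.1 hw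
    obtain ⟨c, rfl⟩ := Submodule.mem_span_singleton.1 hc
    rw [mul_add, mul_smul_comm, mul_one, ← hmul]
    exact W.add_mem (hρW _) (W.smul_mem c (hρW _))
  by_contra ha
  have : IsClosed (W.topologicalClosure : Set C(Ω, ℂ)) := W.isClosed_topologicalClosure
  obtain ⟨g, hg⟩ := SeparatingDual.exists_ne_zero (R := ℂ)
    (mt (Submodule.Quotient.mk_eq_zero W.topologicalClosure).1 ha)
  let l : StrongDual ℂ C(Ω, ℂ) := g ∘L W.topologicalClosure.mkQL
  have hlW : ∀ w ∈ W, l w = 0 := fun w hw => by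
    change g (Submodule.Quotient.mk w) = 0
    rw [(Submodule.Quotient.mk_eq_zero _).2 (W.le_topologicalClosure hw), map_zero]
  obtain ⟨φ, hφ⟩ := exists_positive_dominating l
  let j : C(Ω, ℂ) →ₗ[ℂ] φ.GNS :=
    (UniformSpace.Completion.toComplL (𝕜 := ℂ) (E := φ.PreGNS)).toLinearMap ∘ₗ
      φ.toPreGNS.toLinearMap
  have hj : ∀ b, j b = (φ.toPreGNS b : φ.GNS) := fun b => rfl
  have hlj : ∀ b, ‖l b‖ ≤ ‖j b‖ := fun b =>
    (sq_le_sq₀ (norm_nonneg _) (norm_nonneg _)).1 ((hφ b).trans_eq (norm_sq_toPreGNS φ b).symm)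
  let K : Submodule ℂ φ.GNS := (W.map j).topologicalClosure
  have : CompleteSpace K := (W.map j).isClosed_topologicalClosure.completeSpace_coe
  have hK : ∀ a, ∀ x ∈ K, gnsRestrict φ ρ a x ∈ K := by
    intro a x hx
    refine map_mem_closure (gnsRestrict φ ρ a).continuous hx ?_
    rintro _ ⟨w, hw, rfl⟩
    exact ⟨ρ a * w, hρmul a w hw, (gns_apply_toPreGNS φ (ρ a) w).symm⟩
  have hn : ∀ a, IsStarNormal (gnsRestrict φ ρ a) := fun a => by
    rw [gnsRestrict_apply]
    infer_instance
  -- The constants were put into `W` so that the vector of `1` lies in `K`; the adjoint of `π a`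
  -- sends it to the vector of `star (ρ a)`.
  have h := hX.adjoint_mem (gnsRestrict φ ρ) (fun a b => by simp [gnsRestrict_apply, hmul])
    (completelyContractiveOn_gnsRestrict φ ρ hρ X) hn K hK a
    ((W.map j).le_topologicalClosure ⟨1, h1W, rfl⟩)
  rw [gnsRestrict_apply, ← map_star, hj, gns_apply_toPreGNS, mul_one, ← hj] at h
  refine hg (norm_le_zero_iff.1 (le_of_forall_pos_le_add fun ε hε => ?_))
  obtain ⟨_, ⟨w, hw, rfl⟩, hd⟩ := Metric.mem_closure_iff.1 h ε hε
  rw [dist_eq_norm, ← map_sub] at hd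
  have h2 := hlj (star (ρ a) - w)
  rw [map_sub, hlW w hw, sub_zero] at h2
  rw [zero_add]
  exact h2.trans hd.le

/-- The Gelfand transform of a commutative C⋆-algebra that need not be unital. -/
noncomputable def gelfandUnitization (B : Type*) [NonUnitalCommCStarAlgebra B] :
    B →⋆ₙₐ[ℂ] C(WeakDual.characterSpace ℂ (Unitization ℂ B), ℂ) where
  toFun b := gelfandStarTransform (Unitization ℂ B) (b : Unitization ℂ B)
  map_smul' c b := by rw [Unitization.inr_smul, map_smul]; rfl
  map_zero' := by rw [Unitization.inr_zero, map_zero]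
  map_add' b c := by rw [Unitization.inr_add, map_add]
  map_mul' b c := by rw [Unitization.inr_mul, map_mul]
  map_star' b := by rw [Unitization.inr_star, map_star]

lemma gelfandUnitization_apply {B : Type*} [NonUnitalCommCStarAlgebra B] (b : B) :
    gelfandUnitization B b = gelfandStarTransform (Unitization ℂ B) (b : Unitization ℂ B) := rfl

lemma norm_gelfandUnitization {B : Type*} [NonUnitalCommCStarAlgebra B] (b : B) :
    ‖gelfandUnitization B b‖ = ‖b‖ := by
  rw [gelfandUnitization_apply, ← Unitization.norm_inr (𝕜 := ℂ) b]
  exact (gelfandTransform_isometry (Unitization ℂ B)).norm_map_of_map_zero (map_zero _) _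

/-- The Gelfand transform of the unitization is injective, and scalars there have zero component in
`B`. -/
lemma eq_of_gelfandUnitization_eq_add {B : Type*} [NonUnitalCommCStarAlgebra B] {b c : B} {z : ℂ}
    (h : gelfandUnitization B b = gelfandUnitization B c + z • 1) : b = c := by
  rw [gelfandUnitization_apply, gelfandUnitization_apply,
    ← map_one (gelfandStarTransform (Unitization ℂ B)), ← map_smul, ← map_add] at h
  simpa using congrArg (fun x => x.toProd.2) ((gelfandStarTransform (Unitization ℂ B)).injective h)

/-- A uniform algebra whose minimal operator space structure makes it operator amenable is closed
under the involution. -/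
theorem star_mem_of_operatorAmenable {B : Type u} [NonUnitalCommCStarAlgebra B]
    (A : NonUnitalSubalgebra ℂ B) (hA : IsClosed (A : Set B)) {X : OperatorSpaceStructure A}
    (hX : OperatorAmenable X) {a : B} (ha : a ∈ A) : star a ∈ A := by
  let ρ : A →ₗ[ℂ] C(WeakDual.characterSpace ℂ (Unitization ℂ B), ℂ) :=
    { toFun := fun a => gelfandUnitization B a
      map_add' := fun a b => by simp
      map_smul' := fun c a => by simp }
  have hn : ∀ a, ‖ρ a‖ = ‖a‖ := fun a => norm_gelfandUnitization (a : B)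
  have : CompleteSpace A := hA.completeSpace_coe
  have hcl : IsClosed (LinearMap.range ρ : Set C(WeakDual.characterSpace ℂ (Unitization ℂ B), ℂ)) :=
    (AddMonoidHomClass.isometry_of_norm ρ hn).isClosedEmbedding.isClosed_range
  have h := hX.star_mem_topologicalClosure ρ (fun a b => map_mul (gelfandUnitization B) (a : B) b)
    (fun a => (hn a).le) ⟨a, ha⟩
  -- The isometric image of the complete algebra is closed and stays closed after adding a line, so
  -- approximation becomes membership.
  rw [(Submodule.isClosed_sup_finiteDimensional _ _ hcl).submodule_topologicalClosure_eq] at h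
  obtain ⟨_, ⟨b, rfl⟩, _, hc, hb⟩ := Submodule.mem_sup.1 h
  obtain ⟨z, rfl⟩ := Submodule.mem_span_singleton.1 hc
  rw [eq_of_gelfandUnitization_eq_add (b := star a) (c := b) (z := z)
    ((map_star (gelfandUnitization B) a).trans hb.symm)]
  exact b.2

end ContinuousFunctions

end OpSp

theorem mainTheorem1 {B : Type u} [NonUnitalCommCStarAlgebra B] (A : NonUnitalSubalgebra ℂ B)
    (hA : IsClosed (A : Set B)) (hamen : OpSp.OperatorAmenable (OpSp.minStructure A)) :
    ∃ S : NonUnitalStarSubalgebra ℂ B, IsClosed (S : Set B) ∧ S.toNonUnitalSubalgebra = A :=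
  ⟨{ A with star_mem' := OpSp.star_mem_of_operatorAmenable A hA hamen }, hA, rfl⟩
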